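/- Sequents $\Gamma\Rightarrow\Delta$ are pairs of finite multisets of formulas. Formulas are built from a set of atoms. The substructural language has the constants $\top,\bot,1,0$ and the binary connectives $\wedge,\vee,\to,*,+$; the classical language has $\top,\bot$ and $\wedge,\vee,\to$. Either language may contain an arbitrary set of further connectives of finite arity, on which no logical rule is imposed (other than the modal rules below for a designated $\Box$). $\mathbf{CFL_e}$ is the multi-conclusion sequent calculus with axioms $\phi\Rightarrow\phi$; $\Gamma\Rightarrow\top,\Delta$; $\Gamma,\bot\Rightarrow\Delta$; $\Rightarrow 1$; $0\Rightarrow$; and the rules (premises / conclusion) - $\Gamma\Rightarrow\Delta\ /\ \Gamma,1\Rightarrow\Delta$ and $\Gamma\Rightarrow\Delta\ /\ \Gamma\Rightarrow 0,\Delta$; - $\Gamma,\phi_i\Rightarrow\Delta\ /\ \Gamma,\phi_1\wedge\phi_2\Rightarrow\Delta$ ($i=1,2$) and $\Gamma\Rightarrow\phi,\Delta;\ \Gamma\Rightarrow\psi,\Delta\ /\ \Gamma\Rightarrow\phi\wedge\psi,\Delta$; - $\Gamma,\phi\Rightarrow\Delta;\ \Gamma,\psi\Rightarrow\Delta\ /\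 \Gamma,\phi\vee\psi\Rightarrow\Delta$ and $\Gamma\Rightarrow\phi_i,\Delta\ /\ \Gamma\Rightarrow\phi_1\vee\phi_2,\Delta$ ($i=1,2$); - $\Gamma,\phi,\psi\Rightarrow\Delta\ /\ \Gamma,\phi*\psi\Rightarrow\Delta$ and $\Gamma\Rightarrow\phi,\Delta;\ \Sigma\Rightarrow\psi,\Lambda\ /\ \Gamma,\Sigma\Rightarrow\phi*\psi,\Delta,\Lambda$; - $\Gamma\Rightarrow\phi,\Delta;\ \Sigma,\psi\Rightarrow\Lambda\ /\ \Gamma,\Sigma,\phi\to\psi\Rightarrow\Delta,\Lambda$ and $\Gamma,\phi\Rightarrow\psi,\Delta\ /\ \Gamma\Rightarrow\phi\to\psi,\Delta$; - $\Gamma,\phi\Rightarrow\Delta;\ \Sigma,\psi\Rightarrow\Lambda\ /\ \Gamma,\Sigma,\phi+\psi\Rightarrow\Delta,\Lambda$ and $\Gamma\Rightarrow\phi,\psi,\Delta\ /\ \Gamma\Rightarrow\phi+\psi,\Delta$. $\mathbf{CFL_{ew}}$ adds left and right weakening, $\Gamma\Rightarrow\Delta\ /\ \Gamma,\phi\Rightarrow\Delta$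 and $\Gamma\Rightarrow\Delta\ /\ \Gamma\Rightarrow\phi,\Delta$. $\mathbf{CPC}$ is Gentzen's calculus for the classical language: the above identity axiom, the axioms for $\top,\bot$, the above rules for $\wedge,\vee,\to$, and left and right weakening and contraction. The $\mathbf{K}$ modal version of each of the three systems is obtained by designating a unary connective $\Box$ of the language and adding the rule $(K)$: $\Gamma\Rightarrow\phi\ /\ \Box\Gamma\Rightarrow\Box\phi$; the $\mathbf{KD}$ modal version adds both $(K)$ and the rule $(D)$: $\Gamma\Rightarrow\ /\ \Box\Gamma\Rightarrow$. Here $\Box\Gamma$ is the multiset of all $\Box\gamma$, $\gamma\in\Gamma$, and $\Gamma$ may be empty. The logic $L$ of a system is the set of formulas $\phi$ with $\Rightarrow\phi$ derivable; we then write $L\vdash\phi$. A logic $L$ has the uniform interpolation property if for every formula $\phi$ and every atom $p$ there are formulas $\forall p\,\phi$ and $\exists p\,\phi$ in which $p$ does not occur, such that (i) $L\vdash\forall p\,\phi\to\phi$; (ii) for every formula $\psi$ in which $p$ does not occur, $L\vdash\psi\to\phi$ implies $L\vdash\psi\to\forall p\,\phi$; (iii) $L\vdash\phi\to\exists p\,\phi$;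 (iv) for every formula $\psi$ in which $p$ does not occur, $L\vdash\phi\to\psi$ implies $L\vdash\exists p\,\phi\to\psi$. **Corollary.** The logics $\mathbf{CFL_e}$, $\mathbf{CFL_{ew}}$ and $\mathbf{CPC}$, and the $\mathbf{K}$ and $\mathbf{KD}$ modal versions of each of them, have the uniform interpolation property. -/

import Mathlib

universe u v w

/-- A propositional signature: a type of connectives together with their arities. It lists the
connectives of the language beyond those that the logical rules are about. -/
structure Signature where
  Conn : Type v
  arity : Conn → ℕ

/-- The unary connectives of a signature; one of them plays the role of `□` in a modal logic. -/
abbrev Signature.Unary (σ : Signature.{v}) : Type v := {c : σ.Conn // σ.arity c = 1}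

/-- The modal versions of a calculus: no modal rule, the rule `K`, or the rules `K` and `D`
for the unary connective `b`. -/
inductive ModalVersion (σ : Signature.{v}) : Type v
  | none
  | K (b : σ.Unary)
  | KD (b : σ.Unary)

namespace ModalVersion

/-- The rule `K` is present for the modality `b` (it is whenever `D` is). -/
def HasK {σ : Signature.{v}} (M : ModalVersion σ) (b : σ.Unary) : Prop :=
  M = .K b ∨ M = .KD b

/-- The rule `D` is present for the modality `b`. -/
def HasD {σ : Signature.{v}} (M : ModalVersion σ) (b : σ.Unary) : Prop :=
  M = .KD b

end ModalVersion

/-- Formulas of the substructural language: atoms, the constants `⊤, ⊥, 1, 0`, the connectives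
`∧, ∨, →, *, +`, and the further connectives of `σ`. -/
inductive SubFormula (Atom : Type u) (σ : Signature.{v}) : Type (max u v)
  | atom (p : Atom)
  | top
  | bot
  | one
  | zero
  | and (φ ψ : SubFormula Atom σ)
  | or (φ ψ : SubFormula Atom σ)
  | imp (φ ψ : SubFormula Atom σ)
  | fus (φ ψ : SubFormula Atom σ)
  | add (φ ψ : SubFormula Atom σ)
  | app (c : σ.Conn) (φ : Fin (σ.arity c) → SubFormula Atom σ)

namespace SubFormula

/-- The set of atoms that occur in a formula. -/
def vars {Atom : Type u} {σ : Signature.{v}} : SubFormula Atom σ → Set Atom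
  | atom p => {p}
  | top => ∅
  | bot => ∅
  | one => ∅
  | zero => ∅
  | and φ ψ => vars φ ∪ vars ψ
  | or φ ψ => vars φ ∪ vars ψ
  | imp φ ψ => vars φ ∪ vars ψ
  | fus φ ψ => vars φ ∪ vars ψ
  | add φ ψ => vars φ ∪ vars ψ
  | app _ φ => ⋃ i, vars (φ i)

/-- The formula `□φ`, where the unary connective `b` is the modality. -/
def box {Atom : Type u} {σ : Signature.{v}} (b : σ.Unary) (φ : SubFormula Atom σ) :
    SubFormula Atom σ :=
  app b.1 (fun _ => φ)

/-- Derivability of the sequent `Γ ⇒ Δ` of multisets in the multi-conclusion sequent calculus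
`CFL_e`, with the two weakening rules if `weak` holds, and with the modal rules of `M`. -/
inductive Derives {Atom : Type u} {σ : Signature.{v}} (weak : Prop) (M : ModalVersion σ) :
    Multiset (SubFormula Atom σ) → Multiset (SubFormula Atom σ) → Prop
  | id (φ) : Derives weak M {φ} {φ}
  | topR (Γ Δ) : Derives weak M Γ (top ::ₘ Δ)
  | botL (Γ Δ) : Derives weak M (bot ::ₘ Γ) Δ
  | oneR : Derives weak M 0 {one}
  | zeroL : Derives weak M {zero} 0
  | oneL {Γ Δ} : Derives weak M Γ Δ → Derives weak M (one ::ₘ Γ) Δ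
  | zeroR {Γ Δ} : Derives weak M Γ Δ → Derives weak M Γ (zero ::ₘ Δ)
  | andL₁ {Γ Δ φ} (ψ) :
      Derives weak M (φ ::ₘ Γ) Δ → Derives weak M (and φ ψ ::ₘ Γ) Δ
  | andL₂ {Γ Δ ψ} (φ) :
      Derives weak M (ψ ::ₘ Γ) Δ → Derives weak M (and φ ψ ::ₘ Γ) Δ
  | andR {Γ Δ φ ψ} :
      Derives weak M Γ (φ ::ₘ Δ) → Derives weak M Γ (ψ ::ₘ Δ) →
      Derives weak M Γ (and φ ψ ::ₘ Δ)
  | orL {Γ Δ φ ψ} :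
      Derives weak M (φ ::ₘ Γ) Δ → Derives weak M (ψ ::ₘ Γ) Δ →
      Derives weak M (or φ ψ ::ₘ Γ) Δ
  | orR₁ {Γ Δ φ} (ψ) :
      Derives weak M Γ (φ ::ₘ Δ) → Derives weak M Γ (or φ ψ ::ₘ Δ)
  | orR₂ {Γ Δ ψ} (φ) :
      Derives weak M Γ (ψ ::ₘ Δ) → Derives weak M Γ (or φ ψ ::ₘ Δ)
  | fusL {Γ Δ φ ψ} :
      Derives weak M (φ ::ₘ ψ ::ₘ Γ) Δ → Derives weak M (fus φ ψ ::ₘ Γ) Δ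
  | fusR {Γ Θ Δ Λ φ ψ} :
      Derives weak M Γ (φ ::ₘ Δ) → Derives weak M Θ (ψ ::ₘ Λ) →
      Derives weak M (Γ + Θ) (fus φ ψ ::ₘ (Δ + Λ))
  | impL {Γ Θ Δ Λ φ ψ} :
      Derives weak M Γ (φ ::ₘ Δ) → Derives weak M (ψ ::ₘ Θ) Λ →
      Derives weak M (imp φ ψ ::ₘ (Γ + Θ)) (Δ + Λ)
  | impR {Γ Δ φ ψ} :
      Derives weak M (φ ::ₘ Γ) (ψ ::ₘ Δ) → Derives weak M Γ (imp φ ψ ::ₘ Δ)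
  | addL {Γ Θ Δ Λ φ ψ} :
      Derives weak M (φ ::ₘ Γ) Δ → Derives weak M (ψ ::ₘ Θ) Λ →
      Derives weak M (add φ ψ ::ₘ (Γ + Θ)) (Δ + Λ)
  | addR {Γ Δ φ ψ} :
      Derives weak M Γ (φ ::ₘ ψ ::ₘ Δ) → Derives weak M Γ (add φ ψ ::ₘ Δ)
  | weakL {Γ Δ} (h : weak) (φ) : Derives weak M Γ Δ → Derives weak M (φ ::ₘ Γ) Δ
  | weakR {Γ Δ} (h : weak) (φ) : Derives weak M Γ Δ → Derives weak M Γ (φ ::ₘ Δ)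
  | ruleK {Γ φ} (b : σ.Unary) (h : M.HasK b) :
      Derives weak M Γ {φ} → Derives weak M (Γ.map (box b)) {box b φ}
  | ruleD {Γ} (b : σ.Unary) (h : M.HasD b) :
      Derives weak M Γ 0 → Derives weak M (Γ.map (box b)) 0

end SubFormula

/-- Formulas of the classical language: atoms, `⊤, ⊥, ∧, ∨, →`, and the further connectives
of `σ`. -/
inductive ClFormula (Atom : Type u) (σ : Signature.{v}) : Type (max u v)
  | atom (p : Atom)
  | top
  | bot
  | and (φ ψ : ClFormula Atom σ)
  | or (φ ψ : ClFormula Atom σ)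
  | imp (φ ψ : ClFormula Atom σ)
  | app (c : σ.Conn) (φ : Fin (σ.arity c) → ClFormula Atom σ)

namespace ClFormula

/-- The set of atoms that occur in a formula. -/
def vars {Atom : Type u} {σ : Signature.{v}} : ClFormula Atom σ → Set Atom
  | atom p => {p}
  | top => ∅
  | bot => ∅
  | and φ ψ => vars φ ∪ vars ψ
  | or φ ψ => vars φ ∪ vars ψ
  | imp φ ψ => vars φ ∪ vars ψ
  | app _ φ => ⋃ i, vars (φ i)

/-- The formula `□φ`, where the unary connective `b` is the modality. -/
def box {Atom : Type u} {σ : Signature.{v}} (b : σ.Unary) (φ : ClFormula Atom σ) :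
    ClFormula Atom σ :=
  app b.1 (fun _ => φ)

/-- Derivability of the sequent `Γ ⇒ Δ` of multisets in the classical sequent calculus `LK`,
with the modal rules of `M`. -/
inductive Derives {Atom : Type u} {σ : Signature.{v}} (M : ModalVersion σ) :
    Multiset (ClFormula Atom σ) → Multiset (ClFormula Atom σ) → Prop
  | id (φ) : Derives M {φ} {φ}
  | topR (Γ Δ) : Derives M Γ (top ::ₘ Δ)
  | botL (Γ Δ) : Derives M (bot ::ₘ Γ) Δ
  | andL₁ {Γ Δ φ} (ψ) : Derives M (φ ::ₘ Γ) Δ → Derives M (and φ ψ ::ₘ Γ) Δ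
  | andL₂ {Γ Δ ψ} (φ) : Derives M (ψ ::ₘ Γ) Δ → Derives M (and φ ψ ::ₘ Γ) Δ
  | andR {Γ Δ φ ψ} :
      Derives M Γ (φ ::ₘ Δ) → Derives M Γ (ψ ::ₘ Δ) → Derives M Γ (and φ ψ ::ₘ Δ)
  | orL {Γ Δ φ ψ} :
      Derives M (φ ::ₘ Γ) Δ → Derives M (ψ ::ₘ Γ) Δ → Derives M (or φ ψ ::ₘ Γ) Δ
  | orR₁ {Γ Δ φ} (ψ) : Derives M Γ (φ ::ₘ Δ) → Derives M Γ (or φ ψ ::ₘ Δ)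
  | orR₂ {Γ Δ ψ} (φ) : Derives M Γ (ψ ::ₘ Δ) → Derives M Γ (or φ ψ ::ₘ Δ)
  | impL {Γ Θ Δ Λ φ ψ} :
      Derives M Γ (φ ::ₘ Δ) → Derives M (ψ ::ₘ Θ) Λ →
      Derives M (imp φ ψ ::ₘ (Γ + Θ)) (Δ + Λ)
  | impR {Γ Δ φ ψ} :
      Derives M (φ ::ₘ Γ) (ψ ::ₘ Δ) → Derives M Γ (imp φ ψ ::ₘ Δ)
  | weakL {Γ Δ} (φ) : Derives M Γ Δ → Derives M (φ ::ₘ Γ) Δ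
  | weakR {Γ Δ} (φ) : Derives M Γ Δ → Derives M Γ (φ ::ₘ Δ)
  | contrL {Γ Δ φ} : Derives M (φ ::ₘ φ ::ₘ Γ) Δ → Derives M (φ ::ₘ Γ) Δ
  | contrR {Γ Δ φ} : Derives M Γ (φ ::ₘ φ ::ₘ Δ) → Derives M Γ (φ ::ₘ Δ)
  | ruleK {Γ φ} (b : σ.Unary) (h : M.HasK b) :
      Derives M Γ {φ} → Derives M (Γ.map (box b)) {box b φ}
  | ruleD {Γ} (b : σ.Unary) (h : M.HasD b) :
      Derives M Γ 0 → Derives M (Γ.map (box b)) 0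

end ClFormula

/-- The logic `CFL_e` (for `M = none`) and its modal versions, as sets of theorems. -/
def CFLe (Atom : Type u) {σ : Signature.{v}} (M : ModalVersion σ) : Set (SubFormula Atom σ) :=
  {φ | SubFormula.Derives False M 0 {φ}}

/-- The logic `CFL_ew` (for `M = none`) and its modal versions, as sets of theorems. -/
def CFLew (Atom : Type u) {σ : Signature.{v}} (M : ModalVersion σ) : Set (SubFormula Atom σ) :=
  {φ | SubFormula.Derives True M 0 {φ}}

/-- Classical propositional logic `CPC` (for `M = none`) and its modal versions, as sets of
theorems. -/
def CPC (Atom : Type u) {σ : Signature.{v}} (M : ModalVersion σ) : Set (ClFormula Atom σ) :=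
  {φ | ClFormula.Derives M 0 {φ}}

/-- Uniform interpolation for a logic `L`, given as a set of formulas in a language with
implication `imp`, where `vars φ` is the set of atoms that occur in `φ`: every formula `φ` has,
for every atom `p`, a `p`-pre-interpolant `A` and a `p`-post-interpolant `E`. -/
def HasUniformInterpolation {Atom : Type u} {F : Type w} (imp : F → F → F)
    (vars : F → Set Atom) (L : Set F) : Prop :=
  ∀ (φ : F) (p : Atom), ∃ A E : F, p ∉ vars A ∧ p ∉ vars E ∧
    imp A φ ∈ L ∧
    (∀ ψ : F, p ∉ vars ψ → imp ψ φ ∈ L → imp ψ A ∈ L) ∧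
    imp φ E ∈ L ∧
    (∀ ψ : F, p ∉ vars ψ → imp φ ψ ∈ L → imp E ψ ∈ L)

/-- Uniform interpolation for a logic in the substructural language. -/
def SubFormula.UniformInterpolation {Atom : Type u} {σ : Signature.{v}}
    (L : Set (SubFormula Atom σ)) : Prop :=
  HasUniformInterpolation SubFormula.imp SubFormula.vars L

/-- Uniform interpolation for a logic in the classical language. -/
def ClFormula.UniformInterpolation {Atom : Type u} {σ : Signature.{v}}
    (L : Set (ClFormula Atom σ)) : Prop :=
  HasUniformInterpolation ClFormula.imp ClFormula.vars L

/-! Treat a sequent as a collection of signed formulas. An interpolant of a partial sequent `S` is a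
`p`-free formula `A` such that `S` becomes derivable when `A` joins its antecedent, and such that
every `p`-free `T` for which `S` together with `T` is derivable stays derivable when `S` is replaced
by `A` in the succedent. An interpolant of `φ` in the succedent is `∀p φ`; the negation of an
interpolant of `φ` in the antecedent is `∃p φ`. Passing between sequents and theorems only needs the
inversion of the right rule for `→`, so cut plays no role.

In the substructural calculi no rule duplicates its principal formula, so interpolants are built by
recursion on the total size of `S`. The interpolant is a finite disjunction, with one disjunct for
each way in which the last inference of a derivation can involve `S`. A rule acting in `S` is
mirrored by a connective: `∧` for additive rules, `*` for multiplicative rules, `□` for a boxed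
succedent. A multiplicative rule acting in `T` may still split `S`, which gives `+`, and a modal
rule acting in `T` may still unbox `S`, which gives `¬□¬`. All other inferences in `T` leave `S`
intact and are absorbed by an induction on derivations. The two halves are `Disjunct.sound` and
`Derivable.complete`.

Classically, contraction destroys this size argument. The calculus is replaced by one on sets of
signed formulas whose propositional rules are invertible (`Derivable.of_covers`). Inversion reduces
`S` to sequents on which no propositional rule acts, and there only identity axioms and modal rules
can still link `S` to `T`. -/

namespace Multiset

/-! ### Decompositions of multisets along sums. -/

theorem cons_eq_add {α : Type*} {x : α} {U S T : Multiset α} (h : x ::ₘ U = S + T) :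
    (∃ S', S = x ::ₘ S' ∧ U = S' + T) ∨ (∃ T', T = x ::ₘ T' ∧ U = S + T') := by
  have hx : x ∈ S + T := h ▸ mem_cons_self x U
  rcases mem_add.1 hx with hx | hx
  · obtain ⟨S', rfl⟩ := exists_cons_of_mem hx
    exact .inl ⟨S', rfl, by simpa using h⟩
  · obtain ⟨T', rfl⟩ := exists_cons_of_mem hx
    exact .inr ⟨T', rfl, by simpa using h⟩

theorem eq_of_cons_eq_singleton {α : Type*} {x y : α} {U : Multiset α} (h : x ::ₘ U = {y}) :
    x = y ∧ U = 0 := by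
  have hU : U = 0 := by simpa using congrArg card h
  subst hU
  exact ⟨singleton_inj.1 h, rfl⟩

/-- Two splittings of one multiset have a common refinement. It is needed when a multiplicative rule
splits its context across the division of the sequent into `S` and `T`. -/
theorem exists_refinement_of_add_eq_add {α : Type*} {U V S T : Multiset α} (h : U + V = S + T) :
    ∃ S₁ S₂ T₁ T₂, S = S₁ + S₂ ∧ T = T₁ + T₂ ∧ U = S₁ + T₁ ∧ V = S₂ + T₂ := by
  induction U using Multiset.induction_on generalizing S T with
  | empty => exact ⟨0, S, 0, T, by simp, by simp, by simp, by simpa using h⟩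
  | cons x U ih =>
    rw [cons_add] at h
    rcases cons_eq_add h with ⟨S', rfl, h'⟩ | ⟨T', rfl, h'⟩
    · obtain ⟨S₁, S₂, T₁, T₂, rfl, rfl, rfl, rfl⟩ := ih h'
      exact ⟨x ::ₘ S₁, S₂, T₁, T₂, by simp, rfl, by simp, rfl⟩
    · obtain ⟨S₁, S₂, T₁, T₂, rfl, rfl, rfl, rfl⟩ := ih h'
      exact ⟨S₁, S₂, x ::ₘ T₁, T₂, rfl, by simp, by simp, rfl⟩

theorem exists_of_map_eq_add {α β : Type*} {f : α → β} {U : Multiset α} {S T : Multiset β}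
    (h : U.map f = S + T) : ∃ U₁ U₂, U = U₁ + U₂ ∧ S = U₁.map f ∧ T = U₂.map f := by
  induction U using Multiset.induction_on generalizing S T with
  | empty =>
    have h0 := h.symm
    simp only [map_zero, _root_.add_eq_zero] at h0
    exact ⟨0, 0, by simp, by simp [h0.1], by simp [h0.2]⟩
  | cons x U ih =>
    rw [map_cons] at h
    rcases cons_eq_add h with ⟨S', rfl, h'⟩ | ⟨T', rfl, h'⟩
    · obtain ⟨U₁, U₂, rfl, rfl, rfl⟩ := ih h'
      exact ⟨x ::ₘ U₁, U₂, by simp, by simp, rfl⟩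
    · obtain ⟨U₁, U₂, rfl, rfl, rfl⟩ := ih h'
      exact ⟨U₁, x ::ₘ U₂, by simp, rfl, by simp⟩

theorem finite_setOf_le {α : Type*} (S : Multiset α) : {T | T ≤ S}.Finite := by
  classical exact (Set.finite_Iic S)

end Multiset

/-! ### Substructural formulas and a one-sided calculus with rules grouped by shape. -/

namespace SubFormula

variable {Atom : Type u} {σ : Signature.{v}}

/-- The number of connectives and atoms in a formula. -/
def size : SubFormula Atom σ → ℕ
  | atom _ => 1
  | top => 1
  | bot => 1
  | one => 1
  | zero => 1
  | and φ ψ => φ.size + ψ.size + 1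
  | or φ ψ => φ.size + ψ.size + 1
  | imp φ ψ => φ.size + ψ.size + 1
  | fus φ ψ => φ.size + ψ.size + 1
  | add φ ψ => φ.size + ψ.size + 1
  | app _ φ => (∑ i, (φ i).size) + 1

theorem size_pos (φ : SubFormula Atom σ) : 0 < φ.size := by
  cases φ <;> simp [size]

theorem size_box (b : σ.Unary) (φ : SubFormula Atom σ) : (box b φ).size = φ.size + 1 := by
  obtain ⟨c, hc⟩ := b
  simp [box, size, hc]

theorem vars_box (b : σ.Unary) (φ : SubFormula Atom σ) : (box b φ).vars = φ.vars := by
  obtain ⟨c, hc⟩ := b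
  have : Nonempty (Fin (σ.arity c)) := ⟨⟨0, by omega⟩⟩
  simp [box, vars, Set.iUnion_const]

theorem box_injective (b : σ.Unary) : Function.Injective (box (Atom := Atom) b) := by
  intro φ ψ h
  obtain ⟨c, hc⟩ := b
  have : Nonempty (Fin (σ.arity c)) := ⟨⟨0, by omega⟩⟩
  simp only [box, app.injEq, heq_eq_eq, true_and] at h
  exact congrFun h (Classical.arbitrary _)

/-- Formulas with a side: `inl φ` stands for `φ` in the antecedent and `inr φ` for `φ` in the
succedent of a sequent. -/
abbrev Signed (Atom : Type u) (σ : Signature.{v}) := SubFormula Atom σ ⊕ SubFormula Atom σ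

namespace Signed

/-- The underlying formula of a signed formula. -/
def form : Signed Atom σ → SubFormula Atom σ := Sum.elim id id

@[simp] theorem form_inl (φ : SubFormula Atom σ) : form (.inl φ) = φ := rfl

@[simp] theorem form_inr (φ : SubFormula Atom σ) : form (.inr φ) = φ := rfl

/-- The atom `p` does not occur in the sequent `S`. -/
def Free (p : Atom) (S : Multiset (Signed Atom σ)) : Prop := ∀ x ∈ S, p ∉ x.form.vars

@[simp] theorem free_cons {p : Atom} {x : Signed Atom σ} {S : Multiset (Signed Atom σ)} :
    Free p (x ::ₘ S) ↔ p ∉ x.form.vars ∧ Free p S := by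
  simp [Free]

@[simp] theorem free_add {p : Atom} {S T : Multiset (Signed Atom σ)} :
    Free p (S + T) ↔ Free p S ∧ Free p T := by
  simp [Free, or_imp, forall_and]

@[simp] theorem free_zero {p : Atom} : Free p (0 : Multiset (Signed Atom σ)) := by
  simp [Free]

@[simp] theorem free_singleton {p : Atom} {x : Signed Atom σ} : Free p {x} ↔ p ∉ x.form.vars := by
  simp [Free]

/-- The total size of a sequent. -/
def weight (S : Multiset (Signed Atom σ)) : ℕ := (S.map fun x => x.form.size).sum

@[simp] theorem weight_zero : weight (0 : Multiset (Signed Atom σ)) = 0 := rfl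

@[simp] theorem weight_cons (x : Signed Atom σ) (S : Multiset (Signed Atom σ)) :
    weight (x ::ₘ S) = x.form.size + weight S := by
  simp [weight]

@[simp] theorem weight_add (S T : Multiset (Signed Atom σ)) :
    weight (S + T) = weight S + weight T := by
  simp [weight]

@[simp] theorem weight_singleton (x : Signed Atom σ) : weight {x} = x.form.size := by
  simp [weight]

theorem weight_pos {S : Multiset (Signed Atom σ)} (h : S ≠ 0) : 0 < weight S := by
  obtain ⟨x, hx⟩ := Multiset.exists_mem_of_ne_zero h
  obtain ⟨S', rfl⟩ := Multiset.exists_cons_of_mem hx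
  have := size_pos x.form
  simp only [weight_cons]
  omega

theorem weight_map_inl_box (b : σ.Unary) (Γ : Multiset (SubFormula Atom σ)) :
    weight (Γ.map fun φ => .inl (box b φ)) = weight (Γ.map .inl) + Γ.card := by
  induction Γ using Multiset.induction_on with
  | empty => simp
  | cons φ Γ ih => simp [ih, size_box]; omega

theorem free_map_inl_box {p : Atom} {b : σ.Unary} {Γ : Multiset (SubFormula Atom σ)}
    (h : Free p (Γ.map fun φ => .inl (box b φ))) : Free p (Γ.map .inl) := by
  intro x hx
  obtain ⟨φ, hφ, rfl⟩ := Multiset.mem_map.1 hx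
  have := h _ (Multiset.mem_map_of_mem _ hφ)
  simpa [vars_box] using this

/-- Signed formulas that make every sequent they occur in an axiom. -/
inductive Closing : Signed Atom σ → Prop
  | topR : Closing (.inr top)
  | botL : Closing (.inl bot)

/-- Signed formulas that form an axiom on their own. -/
inductive Unit : Signed Atom σ → Prop
  | oneR : Unit (.inr one)
  | zeroL : Unit (.inl zero)

/-- `Unary weak x α`: a rule infers `x, S` from `α, S`. -/
inductive Unary (weak : Prop) : Signed Atom σ → Multiset (Signed Atom σ) → Prop
  | weaken (h : weak) (x) : Unary weak x 0
  | oneL : Unary weak (.inl one) 0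
  | zeroR : Unary weak (.inr zero) 0
  | andL₁ (φ ψ) : Unary weak (.inl (and φ ψ)) {.inl φ}
  | andL₂ (φ ψ) : Unary weak (.inl (and φ ψ)) {.inl ψ}
  | orR₁ (φ ψ) : Unary weak (.inr (or φ ψ)) {.inr φ}
  | orR₂ (φ ψ) : Unary weak (.inr (or φ ψ)) {.inr ψ}
  | fusL (φ ψ) : Unary weak (.inl (fus φ ψ)) {.inl φ, .inl ψ}
  | impR (φ ψ) : Unary weak (.inr (imp φ ψ)) {.inl φ, .inr ψ}
  | addR (φ ψ) : Unary weak (.inr (add φ ψ)) {.inr φ, .inr ψ}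

/-- `Additive x y z`: a rule infers `x, S` from `y, S` and `z, S`. -/
inductive Additive : Signed Atom σ → Signed Atom σ → Signed Atom σ → Prop
  | andR (φ ψ) : Additive (.inr (and φ ψ)) (.inr φ) (.inr ψ)
  | orL (φ ψ) : Additive (.inl (or φ ψ)) (.inl φ) (.inl ψ)

/-- `Multiplicative x y z`: a rule infers `x, S, T` from `y, S` and `z, T`. -/
inductive Multiplicative : Signed Atom σ → Signed Atom σ → Signed Atom σ → Prop
  | fusR (φ ψ) : Multiplicative (.inr (fus φ ψ)) (.inr φ) (.inr ψ)
  | impL (φ ψ) : Multiplicative (.inl (imp φ ψ)) (.inr φ) (.inl ψ)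
  | addL (φ ψ) : Multiplicative (.inl (add φ ψ)) (.inl φ) (.inl ψ)

/-- The strict decrease that makes the recursion on sequents terminate; weakening fits because its
premise adds nothing, and a contraction rule would violate it. -/
theorem Unary.weight_lt {weak : Prop} {x : Signed Atom σ} {α : Multiset (Signed Atom σ)}
    (h : Unary weak x α) : weight α < x.form.size := by
  cases h <;> simp [size, size_pos]

theorem Additive.size_lt {x y z : Signed Atom σ} (h : Additive x y z) :
    y.form.size < x.form.size ∧ z.form.size < x.form.size := by
  cases h <;> simp [size]

theorem Multiplicative.size_lt {x y z : Signed Atom σ} (h : Multiplicative x y z) :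
    y.form.size < x.form.size ∧ z.form.size < x.form.size := by
  cases h <;> simp [size]

/-- The subformula property: a `p`-free context remains `p`-free in the premises of a rule acting on
it. -/
theorem Unary.free {weak : Prop} {x : Signed Atom σ} {α : Multiset (Signed Atom σ)}
    (h : Unary weak x α) {p : Atom} (hp : p ∉ x.form.vars) : Free p α := by
  cases h <;> simp_all [vars]

theorem Additive.free {x y z : Signed Atom σ} (h : Additive x y z) {p : Atom}
    (hp : p ∉ x.form.vars) : p ∉ y.form.vars ∧ p ∉ z.form.vars := by
  cases h <;> simp_all [vars]

theorem Multiplicative.free {x y z : Signed Atom σ} (h : Multiplicative x y z) {p : Atom}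
    (hp : p ∉ x.form.vars) : p ∉ y.form.vars ∧ p ∉ z.form.vars := by
  cases h <;> simp_all [vars]

/-- The immediate subformulas of a binary formula. -/
def args : SubFormula Atom σ → SubFormula Atom σ × SubFormula Atom σ
  | and φ ψ => (φ, ψ)
  | or φ ψ => (φ, ψ)
  | imp φ ψ => (φ, ψ)
  | fus φ ψ => (φ, ψ)
  | add φ ψ => (φ, ψ)
  -- An arbitrary value: on the remaining formulas the only possible inferences add no component to
  -- the premise.
  | φ => (φ, φ)

theorem finite_unary (weak : Prop) (x : Signed Atom σ) : {α | Unary weak x α}.Finite := by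
  let φ := (args x.form).1
  let ψ := (args x.form).2
  refine Set.Finite.subset (s := {0, {.inl φ}, {.inl ψ}, {.inr φ}, {.inr ψ}, {.inl φ, .inl ψ},
    {.inl φ, .inr ψ}, {.inr φ, .inr ψ}}) (Set.toFinite _) ?_
  rintro α (h : Unary weak x α)
  cases h <;> simp [φ, ψ, args]

theorem finite_additive (x : Signed Atom σ) :
    {q : Signed Atom σ × Signed Atom σ | Additive x q.1 q.2}.Finite := by
  let φ := (args x.form).1
  let ψ := (args x.form).2
  refine Set.Finite.subset (s := {(.inl φ, .inl ψ), (.inr φ, .inr ψ)}) (Set.toFinite _) ?_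
  rintro ⟨y, z⟩ (h : Additive x y z)
  cases h <;> simp [φ, ψ, args]

theorem finite_multiplicative (x : Signed Atom σ) :
    {q : Signed Atom σ × Signed Atom σ | Multiplicative x q.1 q.2}.Finite := by
  let φ := (args x.form).1
  let ψ := (args x.form).2
  refine Set.Finite.subset (s := {(.inl φ, .inl ψ), (.inr φ, .inr ψ), (.inr φ, .inl ψ)})
    (Set.toFinite _) ?_
  rintro ⟨y, z⟩ (h : Multiplicative x y z)
  cases h <;> simp [φ, ψ, args]

/-- Derivability of one-sided sequents, that is, multisets of signed formulas. -/
inductive Derivable (weak : Prop) (M : ModalVersion σ) : Multiset (Signed Atom σ) → Prop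
  | id (φ) : Derivable weak M {.inl φ, .inr φ}
  | closing {x} (h : Closing x) (S) : Derivable weak M (x ::ₘ S)
  | unit {x} (h : Unit x) : Derivable weak M {x}
  | unary {x α S} (h : Unary weak x α) :
      Derivable weak M (α + S) → Derivable weak M (x ::ₘ S)
  | additive {x y z S} (h : Additive x y z) :
      Derivable weak M (y ::ₘ S) → Derivable weak M (z ::ₘ S) → Derivable weak M (x ::ₘ S)
  | multiplicative {x y z S T} (h : Multiplicative x y z) :
      Derivable weak M (y ::ₘ S) → Derivable weak M (z ::ₘ T) →
      Derivable weak M (x ::ₘ (S + T))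
  | ruleK {Γ : Multiset (SubFormula Atom σ)} {φ} (b : σ.Unary) (h : M.HasK b) :
      Derivable weak M (.inr φ ::ₘ Γ.map .inl) →
      Derivable weak M (.inr (box b φ) ::ₘ Γ.map fun ψ => .inl (box b ψ))
  | ruleD {Γ : Multiset (SubFormula Atom σ)} (b : σ.Unary) (h : M.HasD b) :
      Derivable weak M (Γ.map .inl) → Derivable weak M (Γ.map fun ψ => .inl (box b ψ))

end Signed

/-! ### Translation between two-sided and one-sided substructural sequents. -/

/-- The one-sided version of the sequent `Γ ⇒ Δ`. -/
def oneSided (Γ Δ : Multiset (SubFormula Atom σ)) : Multiset (Signed Atom σ) :=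
  Γ.map .inl + Δ.map .inr

@[simp] theorem oneSided_zero : oneSided (0 : Multiset (SubFormula Atom σ)) 0 = 0 := rfl

@[simp] theorem oneSided_cons_left (φ : SubFormula Atom σ) (Γ Δ : Multiset (SubFormula Atom σ)) :
    oneSided (φ ::ₘ Γ) Δ = .inl φ ::ₘ oneSided Γ Δ := by
  simp [oneSided]

@[simp] theorem oneSided_cons_right (φ : SubFormula Atom σ) (Γ Δ : Multiset (SubFormula Atom σ)) :
    oneSided Γ (φ ::ₘ Δ) = .inr φ ::ₘ oneSided Γ Δ := by
  simp [oneSided]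

theorem oneSided_singleton_right (φ : SubFormula Atom σ) (Γ : Multiset (SubFormula Atom σ)) :
    oneSided Γ {φ} = .inr φ ::ₘ Γ.map .inl := by
  rw [oneSided, add_comm, Multiset.map_singleton, Multiset.singleton_add]

theorem oneSided_add (Γ Θ Δ Λ : Multiset (SubFormula Atom σ)) :
    oneSided (Γ + Θ) (Δ + Λ) = oneSided Γ Δ + oneSided Θ Λ := by
  simp only [oneSided, Multiset.map_add]
  abel

theorem Derives.oneSided {weak : Prop} {M : ModalVersion σ}
    {Γ Δ : Multiset (SubFormula Atom σ)} (h : Derives weak M Γ Δ) :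
    Signed.Derivable weak M (oneSided Γ Δ) := by
  induction h with
  | id φ => exact .id φ
  | topR Γ Δ => simpa using .closing .topR _
  | botL Γ Δ => simpa using .closing .botL _
  | oneR => exact .unit .oneR
  | zeroL => exact .unit .zeroL
  | oneL _ ih => simpa using .unary .oneL (by simpa using ih)
  | zeroR _ ih => simpa using .unary .zeroR (by simpa using ih)
  | andL₁ ψ _ ih => simpa using .unary (.andL₁ _ _) (by simpa using ih)
  | andL₂ φ _ ih => simpa using .unary (.andL₂ _ _) (by simpa using ih)
  | andR _ _ ih₁ ih₂ =>
    simpa using .additive (.andR _ _) (by simpa using ih₁) (by simpa using ih₂)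
  | orL _ _ ih₁ ih₂ => simpa using .additive (.orL _ _) (by simpa using ih₁) (by simpa using ih₂)
  | orR₁ ψ _ ih => simpa using .unary (.orR₁ _ _) (by simpa using ih)
  | orR₂ φ _ ih => simpa using .unary (.orR₂ _ _) (by simpa using ih)
  | fusL _ ih => simpa using .unary (.fusL _ _) (by simpa using ih)
  | fusR _ _ ih₁ ih₂ =>
    simpa [oneSided_add] using
      .multiplicative (.fusR _ _) (by simpa using ih₁) (by simpa using ih₂)
  | impL _ _ ih₁ ih₂ =>
    simpa [oneSided_add] using
      .multiplicative (.impL _ _) (by simpa using ih₁) (by simpa using ih₂)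
  | impR _ ih => simpa using .unary (.impR _ _) (by simpa [Multiset.cons_swap] using ih)
  | addL _ _ ih₁ ih₂ =>
    simpa [oneSided_add] using
      .multiplicative (.addL _ _) (by simpa using ih₁) (by simpa using ih₂)
  | addR _ ih => simpa using .unary (.addR _ _) (by simpa using ih)
  | weakL h φ _ ih => simpa using .unary (.weaken h _) (by simpa using ih)
  | weakR h φ _ ih => simpa using .unary (.weaken h _) (by simpa using ih)
  | ruleK b h _ ih =>
    rw [oneSided_singleton_right] at ih ⊢
    simpa using Signed.Derivable.ruleK b h ih
  | ruleD b h _ ih =>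
    have := Signed.Derivable.ruleD b h (by simpa [SubFormula.oneSided] using ih)
    simpa [SubFormula.oneSided] using this

/-- The antecedent of a one-sided sequent. -/
def lefts (S : Multiset (Signed Atom σ)) : Multiset (SubFormula Atom σ) :=
  S.filterMap Sum.getLeft?

/-- The succedent of a one-sided sequent. -/
def rights (S : Multiset (Signed Atom σ)) : Multiset (SubFormula Atom σ) :=
  S.filterMap Sum.getRight?

@[simp] theorem lefts_zero : lefts (0 : Multiset (Signed Atom σ)) = 0 := rfl

@[simp] theorem rights_zero : rights (0 : Multiset (Signed Atom σ)) = 0 := rfl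

@[simp] theorem lefts_cons_inl (φ : SubFormula Atom σ) (S : Multiset (Signed Atom σ)) :
    lefts (.inl φ ::ₘ S) = φ ::ₘ lefts S :=
  Multiset.filterMap_cons_some _ _ _ rfl

@[simp] theorem lefts_cons_inr (φ : SubFormula Atom σ) (S : Multiset (Signed Atom σ)) :
    lefts (.inr φ ::ₘ S) = lefts S :=
  Multiset.filterMap_cons_none _ _ rfl

@[simp] theorem rights_cons_inl (φ : SubFormula Atom σ) (S : Multiset (Signed Atom σ)) :
    rights (.inl φ ::ₘ S) = rights S :=
  Multiset.filterMap_cons_none _ _ rfl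

@[simp] theorem rights_cons_inr (φ : SubFormula Atom σ) (S : Multiset (Signed Atom σ)) :
    rights (.inr φ ::ₘ S) = φ ::ₘ rights S :=
  Multiset.filterMap_cons_some _ _ _ rfl

@[simp] theorem lefts_add (S T : Multiset (Signed Atom σ)) :
    lefts (S + T) = lefts S + lefts T := by
  induction S using Multiset.induction_on with
  | empty => simp
  | cons x S ih => cases x <;> simp [ih]

@[simp] theorem rights_add (S T : Multiset (Signed Atom σ)) :
    rights (S + T) = rights S + rights T := by
  induction S using Multiset.induction_on with
  | empty => simp
  | cons x S ih => cases x <;> simp [ih]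

@[simp] theorem lefts_map_inl {α : Type*} (Γ : Multiset α) (f : α → SubFormula Atom σ) :
    lefts (Γ.map fun φ => .inl (f φ)) = Γ.map f := by
  induction Γ using Multiset.induction_on with
  | empty => simp
  | cons x S ih => simp [ih]

@[simp] theorem rights_map_inl {α : Type*} (Γ : Multiset α) (f : α → SubFormula Atom σ) :
    rights (Γ.map fun φ => .inl (f φ)) = 0 := by
  induction Γ using Multiset.induction_on with
  | empty => simp
  | cons x S ih => simp [ih]

theorem Signed.Derivable.derives {weak : Prop} {M : ModalVersion σ}
    {S : Multiset (Signed Atom σ)} (h : Derivable weak M S) :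
    Derives weak M (lefts S) (rights S) := by
  induction h with
  | id φ => exact .id φ
  | closing h S =>
    cases h with
    | topR => simpa using .topR _ _
    | botL => simpa using .botL _ _
  | unit h =>
    cases h with
    | oneR => exact .oneR
    | zeroL => exact .zeroL
  | @unary x α S h _ ih =>
    cases h with
    | weaken h x =>
      cases x with
      | inl φ => simpa using .weakL h _ (by simpa using ih)
      | inr φ => simpa using .weakR h _ (by simpa using ih)
    | oneL => simpa using .oneL (by simpa using ih)
    | zeroR => simpa using .zeroR (by simpa using ih)
    | andL₁ φ ψ => simpa using .andL₁ _ (by simpa using ih)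
    | andL₂ φ ψ => simpa using .andL₂ _ (by simpa using ih)
    | orR₁ φ ψ => simpa using .orR₁ _ (by simpa using ih)
    | orR₂ φ ψ => simpa using .orR₂ _ (by simpa using ih)
    | fusL φ ψ => simpa using .fusL (by simpa using ih)
    | impR φ ψ => simpa using .impR (by simpa using ih)
    | addR φ ψ => simpa using .addR (by simpa using ih)
  | additive h _ _ ih₁ ih₂ =>
    cases h with
    | andR φ ψ => simpa using .andR (by simpa using ih₁) (by simpa using ih₂)
    | orL φ ψ => simpa using .orL (by simpa using ih₁) (by simpa using ih₂)
  | multiplicative h _ _ ih₁ ih₂ =>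
    cases h with
    | fusR φ ψ => simpa using .fusR (by simpa using ih₁) (by simpa using ih₂)
    | impL φ ψ => simpa using .impL (by simpa using ih₁) (by simpa using ih₂)
    | addL φ ψ => simpa using .addL (by simpa using ih₁) (by simpa using ih₂)
  | @ruleK Γ φ b h _ ih =>
    have h₁ := lefts_map_inl (Atom := Atom) (σ := σ) Γ _root_.id
    have h₂ := rights_map_inl (Atom := Atom) (σ := σ) Γ _root_.id
    simp only [id_eq, Multiset.map_id'] at h₁ h₂
    simp only [lefts_cons_inr, rights_cons_inr, h₁, h₂] at ih
    simpa using .ruleK b h ih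
  | @ruleD Γ b h _ ih =>
    have h₁ := lefts_map_inl (Atom := Atom) (σ := σ) Γ _root_.id
    have h₂ := rights_map_inl (Atom := Atom) (σ := σ) Γ _root_.id
    simp only [id_eq, Multiset.map_id'] at h₁ h₂
    rw [h₁, h₂] at ih
    simpa using .ruleD b h ih

end SubFormula

/-! ### Uniform interpolants for the substructural calculi. -/

theorem ModalVersion.hasK_of_hasD {σ : Signature.{v}} {M : ModalVersion σ} {b : σ.Unary}
    (h : M.HasD b) : M.HasK b :=
  .inr h

/-- At most one connective is the modality, so the modal disjuncts stay finite in number even if `σ`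
has infinitely many unary connectives. -/
theorem ModalVersion.finite_hasK {σ : Signature.{v}} (M : ModalVersion σ) :
    {b | M.HasK b}.Finite := by
  refine Set.Subsingleton.finite ?_
  rintro b (rfl | rfl) c (h | h) <;> simp_all

namespace SubFormula

namespace Signed

variable {Atom : Type u} {σ : Signature.{v}} {weak : Prop} {M : ModalVersion σ} {p : Atom}

/-- `A` is a uniform `p`-interpolant of the partial sequent `S`: it is `p`-free, it completes `S`
to a derivable sequent, and it follows from every `p`-free context that does so. -/
structure IsInterpolant (weak : Prop) (M : ModalVersion σ) (p : Atom)
    (S : Multiset (Signed Atom σ)) (A : SubFormula Atom σ) : Prop where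
  free : p ∉ A.vars
  left : Derivable weak M (.inl A ::ₘ S)
  right : ∀ T, Free p T → Derivable weak M (S + T) → Derivable weak M (.inr A ::ₘ T)

theorem Derivable.swap {x y : Signed Atom σ} {S : Multiset (Signed Atom σ)}
    (h : Derivable weak M (x ::ₘ y ::ₘ S)) : Derivable weak M (y ::ₘ x ::ₘ S) := by
  rwa [Multiset.cons_swap]

/-- The disjuncts of the interpolant of `S`, one for each way in which the last inference of a
derivation can involve `S`, where `A` gives the interpolants of smaller sequents. -/
inductive Disjunct (weak : Prop) (M : ModalVersion σ) (p : Atom)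
    (A : Multiset (Signed Atom σ) → SubFormula Atom σ) (S : Multiset (Signed Atom σ)) :
    SubFormula Atom σ → Prop
  | derivable (h : Derivable weak M S) : Disjunct weak M p A S one
  | closing {x} (h : Closing x) (hx : x ∈ S) : Disjunct weak M p A S top
  | idL {φ} (hp : p ∉ φ.vars) (hS : S = {.inl φ}) : Disjunct weak M p A S (imp φ zero)
  | idR {φ} (hp : p ∉ φ.vars) (hS : S = {.inr φ}) : Disjunct weak M p A S φ
  | unary {x α S'} (h : Unary weak x α) (hS : S = x ::ₘ S') : Disjunct weak M p A S (A (α + S'))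
  | additive {x y z S'} (h : Additive x y z) (hS : S = x ::ₘ S') :
      Disjunct weak M p A S (and (A (y ::ₘ S')) (A (z ::ₘ S')))
  | multiplicative {x y z S₁ S₂} (h : Multiplicative x y z) (hS : S = x ::ₘ (S₁ + S₂)) :
      Disjunct weak M p A S (fus (A (y ::ₘ S₁)) (A (z ::ₘ S₂)))
  | split {S₁ S₂} (h₁ : S₁ ≠ 0) (h₂ : S₂ ≠ 0) (hS : S = S₁ + S₂) :
      Disjunct weak M p A S (add (A S₁) (A S₂))
  | box {b φ} {Γ : Multiset (SubFormula Atom σ)} (h : M.HasK b)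
      (hS : S = .inr (box b φ) ::ₘ Γ.map fun ψ => .inl (SubFormula.box b ψ)) :
      Disjunct weak M p A S (SubFormula.box b (A (.inr φ ::ₘ Γ.map .inl)))
  | diamond {b} {Γ : Multiset (SubFormula Atom σ)} (h : M.HasK b)
      (hS : S = Γ.map fun ψ => .inl (SubFormula.box b ψ)) :
      Disjunct weak M p A S (imp (SubFormula.box b (imp (A (Γ.map .inl)) zero)) zero)

/-- Each disjunct is determined by a bounded choice: members of `S`, sub-multisets of `S`, and the
finitely many inferences with a given principal formula. Injectivity of `box` makes the multisets
whose boxed image lies in `S` finite in number. -/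
theorem Disjunct.finite (weak : Prop) (M : ModalVersion σ) (p : Atom)
    (A : Multiset (Signed Atom σ) → SubFormula Atom σ) (S : Multiset (Signed Atom σ)) :
    {B | Disjunct weak M p A S B}.Finite := by
  have hmem : {x | x ∈ S}.Finite := by
    classical
    exact S.toFinset.finite_toSet.subset fun x hx => by simpa using hx
  have hle := S.finite_setOf_le
  have hinl (b : σ.Unary) : Function.Injective (fun φ => (.inl (SubFormula.box b φ) : Signed Atom σ)) :=
    fun _ _ h => box_injective b (Sum.inl.inj h)
  have hinr (b : σ.Unary) : Function.Injective (fun φ => (.inr (SubFormula.box b φ) : Signed Atom σ)) :=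
    fun _ _ h => box_injective b (Sum.inr.inj h)
  have hΓ (b : σ.Unary) :
      {Γ : Multiset (SubFormula Atom σ) | Γ.map (fun φ => (.inl (SubFormula.box b φ) : Signed Atom σ)) ≤ S}.Finite :=
    hle.preimage (Multiset.map_injective (hinl b)).injOn
  have hφ (b : σ.Unary) : {φ | (.inr (SubFormula.box b φ) : Signed Atom σ) ∈ S}.Finite :=
    hmem.preimage (hinr b).injOn
  have h₁ : ({one, top} : Set (SubFormula Atom σ)).Finite := Set.toFinite _
  have h₂ := hmem.image (Sum.elim (fun φ => imp φ zero) _root_.id)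
  have h₃ := (hmem.biUnion fun x _ => finite_unary weak x).image2 (fun α S' => A (α + S')) hle
  have h₄ := (hmem.biUnion fun x _ => finite_additive x).image2
    (fun q S' => and (A (q.1 ::ₘ S')) (A (q.2 ::ₘ S'))) hle
  have h₅ := (hmem.biUnion fun x _ => finite_multiplicative x).image2
    (fun q R => fus (A (q.1 ::ₘ R.1)) (A (q.2 ::ₘ R.2))) (hle.prod hle)
  have h₆ := hle.image2 (fun S₁ S₂ => add (A S₁) (A S₂)) hle
  have h₇ := M.finite_hasK.biUnion fun b _ => (hφ b).image2
    (fun φ Γ => SubFormula.box b (A (.inr φ ::ₘ Γ.map .inl))) (hΓ b)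
  have h₈ := M.finite_hasK.biUnion fun b _ => (hΓ b).image
    (fun Γ => imp (SubFormula.box b (imp (A (Γ.map .inl)) zero)) zero)
  refine (h₁.union (h₂.union (h₃.union (h₄.union (h₅.union (h₆.union (h₇.union h₈))))))).subset ?_
  rintro B (h : Disjunct weak M p A S B)
  simp only [Set.mem_union]
  cases h with
  | derivable h => simp
  | closing h hx => simp
  | idL hp hS => exact .inr (.inl ⟨.inl _, by simp [hS], rfl⟩)
  | idR hp hS => exact .inr (.inl ⟨.inr B, by simp [hS], rfl⟩)
  | @unary x α S' h hS =>
    refine .inr (.inr (.inl (Set.mem_image2_of_mem (Set.mem_biUnion (x := x) ?_ h) ?_)))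
    · simp [hS]
    · simpa [hS] using Multiset.le_cons_self S' x
  | @additive x y z S' h hS =>
    refine .inr (.inr (.inr (.inl (Set.mem_image2_of_mem (a := (y, z))
      (Set.mem_biUnion (x := x) ?_ h) ?_))))
    · simp [hS]
    · simpa [hS] using Multiset.le_cons_self S' x
  | @multiplicative x y z S₁ S₂ h hS =>
    have hS' : S₁ + S₂ ≤ S := hS ▸ Multiset.le_cons_self _ x
    refine .inr (.inr (.inr (.inr (.inl (Set.mem_image2_of_mem (a := (y, z)) (b := (S₁, S₂))
      (Set.mem_biUnion (x := x) ?_ h) ⟨?_, ?_⟩)))))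
    · simp [hS]
    · exact (Multiset.le_add_right S₁ S₂).trans hS'
    · exact (Multiset.le_add_left S₂ S₁).trans hS'
  | @split S₁ S₂ _ _ hS =>
    refine .inr (.inr (.inr (.inr (.inr (.inl (Set.mem_image2_of_mem ?_ ?_))))))
    · simp [hS]
    · simp [hS]
  | @box b φ Γ h hS =>
    refine .inr (.inr (.inr (.inr (.inr (.inr (.inl (Set.mem_biUnion h
      (Set.mem_image2_of_mem ?_ ?_))))))))
    · simp [hS]
    · simpa [hS] using Multiset.le_cons_self _ _
  | @diamond b Γ h hS =>
    exact .inr (.inr (.inr (.inr (.inr (.inr (.inr (Set.mem_biUnion h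
      (Set.mem_image_of_mem _ (by simp [hS])))))))))

theorem weight_map_inl_lt {b : σ.Unary} {Γ : Multiset (SubFormula Atom σ)}
    (h : (Γ.map fun ψ => (.inl (box b ψ) : Signed Atom σ)) ≠ 0) :
    weight (Γ.map .inl) < weight (Γ.map fun ψ => (.inl (box b ψ) : Signed Atom σ)) := by
  rw [weight_map_inl_box]
  have : 0 < Γ.card := Multiset.card_pos.2 (by rintro rfl; simp at h)
  omega

theorem Derivable.impR {φ ψ : SubFormula Atom σ} {T : Multiset (Signed Atom σ)}
    (h : Derivable weak M (.inl φ ::ₘ .inr ψ ::ₘ T)) :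
    Derivable weak M (.inr (imp φ ψ) ::ₘ T) :=
  .unary (.impR _ _) (by simpa using h)

theorem Derivable.negL {A : SubFormula Atom σ} {T : Multiset (Signed Atom σ)}
    (h : Derivable weak M (.inr A ::ₘ T)) : Derivable weak M (.inl (imp A zero) ::ₘ T) := by
  simpa using Derivable.multiplicative (T := 0) (.impL A zero) h (.unit .zeroL)

theorem Derivable.negR {A : SubFormula Atom σ} {T : Multiset (Signed Atom σ)}
    (h : Derivable weak M (.inl A ::ₘ T)) : Derivable weak M (.inr (imp A zero) ::ₘ T) :=
  .impR (.swap (.unary .zeroR (by simpa using h)))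

/-- Replay the inference that the disjunct stands for, with the interpolants of the parts of `S`
placed in the antecedents of its premises. -/
theorem Disjunct.sound {A : Multiset (Signed Atom σ) → SubFormula Atom σ}
    {S : Multiset (Signed Atom σ)} (hS₀ : S ≠ 0)
    (hA : ∀ S', weight S' < weight S → IsInterpolant weak M p S' (A S'))
    {B : SubFormula Atom σ} (hB : Disjunct weak M p A S B) :
    p ∉ B.vars ∧ Derivable weak M (.inl B ::ₘ S) := by
  cases hB with
  | derivable h => exact ⟨by simp [vars], .unary .oneL (by simpa using h)⟩
  | closing h hx =>
    obtain ⟨S', rfl⟩ := Multiset.exists_cons_of_mem hx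
    exact ⟨by simp [vars], (Derivable.closing h _).swap⟩
  | @idL φ hp hS =>
    subst hS
    refine ⟨by simp [vars, hp], ?_⟩
    simpa using Derivable.multiplicative (S := {.inl φ}) (T := 0) (.impL φ zero)
      (Derivable.id φ).swap (.unit .zeroL)
  | idR hp hS => subst hS; exact ⟨hp, .id _⟩
  | @unary x α S' h hS =>
    subst hS
    have hI := hA (α + S') (by have := h.weight_lt; simp; omega)
    refine ⟨hI.free, Derivable.swap (.unary h ?_)⟩
    simpa using hI.left
  | @additive x y z S' h hS =>
    subst hS
    have hy := hA (y ::ₘ S') (by have := h.size_lt; simp; omega)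
    have hz := hA (z ::ₘ S') (by have := h.size_lt; simp; omega)
    exact ⟨by simp [vars, hy.free, hz.free], Derivable.swap (.additive h
      (Derivable.swap (.unary (.andL₁ _ _) hy.left))
      (Derivable.swap (.unary (.andL₂ _ _) hz.left)))⟩
  | @multiplicative x y z S₁ S₂ h hS =>
    subst hS
    have hy := hA (y ::ₘ S₁) (by have := h.size_lt; simp; omega)
    have hz := hA (z ::ₘ S₂) (by have := h.size_lt; simp; omega)
    refine ⟨by simp [vars, hy.free, hz.free], .unary (.fusL _ _) ?_⟩
    have := Derivable.multiplicative h hy.left.swap hz.left.swap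
    convert this using 1
    simp only [Multiset.insert_eq_cons, ← Multiset.singleton_add]
    abel
  | @split S₁ S₂ h₁ h₂ hS =>
    subst hS
    have hy := hA S₁ (by have := weight_pos h₂; simp; omega)
    have hz := hA S₂ (by have := weight_pos h₁; simp; omega)
    exact ⟨by simp [vars, hy.free, hz.free], .multiplicative (.addL _ _) hy.left hz.left⟩
  | @box b φ Γ h hS =>
    subst hS
    have hI := hA (.inr φ ::ₘ Γ.map .inl) (by simp [size_box, weight_map_inl_box]; omega)
    refine ⟨by rw [vars_box]; exact hI.free, ?_⟩
    have := Derivable.ruleK (Γ := A (.inr φ ::ₘ Γ.map .inl) ::ₘ Γ) b h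
      (by simpa using hI.left.swap)
    simpa using (by simpa using this : Derivable weak M (_ ::ₘ _ ::ₘ _)).swap
  | @diamond b Γ h hS =>
    subst hS
    have hI := hA (Γ.map .inl) (weight_map_inl_lt hS₀)
    refine ⟨by simp [vars, vars_box, hI.free], ?_⟩
    -- From `A, Γ ⇒` obtain `Γ ⇒ ¬A`, then `□Γ ⇒ □¬A` by `K`, then `¬□¬A, □Γ ⇒`. The rule `D` is not
    -- needed for soundness.
    exact Derivable.negL (.ruleK b h hI.left.negR)

theorem exists_disjunction {s : Set (SubFormula Atom σ)} (hs : s.Finite)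
    {S : Multiset (Signed Atom σ)}
    (h : ∀ B ∈ s, p ∉ B.vars ∧ Derivable weak M (.inl B ::ₘ S)) :
    ∃ A : SubFormula Atom σ, p ∉ A.vars ∧ Derivable weak M (.inl A ::ₘ S) ∧
      ∀ B ∈ s, ∀ T, Derivable weak M (.inr B ::ₘ T) → Derivable weak M (.inr A ::ₘ T) := by
  induction s, hs using Set.Finite.induction_on with
  | empty => exact ⟨bot, by simp [vars], .closing .botL _, by simp⟩
  | @insert B s _ _ ih =>
    obtain ⟨A, hp, hl, hr⟩ := ih fun B hB => h B (.inr hB)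
    obtain ⟨hp', hl'⟩ := h B (.inl rfl)
    refine ⟨or B A, by simp [vars, hp, hp'], .additive (.orL _ _) hl' hl, ?_⟩
    rintro C (rfl | hC) T hT
    · exact .unary (.orR₁ _ _) hT
    · exact .unary (.orR₂ _ _) (hr C hC T hT)

/-- Induction on the derivation with `S` fixed and `T` varying. If the last inference acts in `S` or
breaks it up, a disjunct applies and the interpolants of smaller sequents suffice; if it acts in `T`
and leaves `S` whole in a premise, the induction hypothesis applies to that premise. -/
theorem Derivable.complete {A : Multiset (Signed Atom σ) → SubFormula Atom σ}
    {S : Multiset (Signed Atom σ)} (hS₀ : S ≠ 0)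
    (hA : ∀ S', weight S' < weight S → IsInterpolant weak M p S' (A S'))
    {D : SubFormula Atom σ}
    (hD : ∀ B, Disjunct weak M p A S B → ∀ T, Derivable weak M (.inr B ::ₘ T) →
      Derivable weak M (.inr D ::ₘ T))
    {U : Multiset (Signed Atom σ)} (hU : Derivable weak M U) :
    ∀ T, Free p T → U = S + T → Derivable weak M (.inr D ::ₘ T) := by
  induction hU with
  | id φ =>
    intro T hT hU
    have hd : Derivable weak M {.inl φ, .inr φ} := .id φ
    rcases Multiset.cons_eq_add (U := ({.inr φ} : Multiset (Signed Atom σ))) hU with ⟨S', rfl, h₁⟩ | ⟨T', rfl, h₁⟩ <;>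
    rcases Multiset.cons_eq_add (U := 0) h₁ with ⟨S'', rfl, h₂⟩ | ⟨T'', rfl, h₂⟩ <;>
    obtain ⟨rfl, rfl⟩ := add_eq_zero.1 h₂.symm
    -- Both copies of `φ` lie in `S`, so `T` is empty and the disjunct `1` is provable outright.
    -- Without weakening, this disjunct is of use only for empty `T`.
    · exact hD _ (.derivable hd) _ (.unit .oneR)
    · exact hD _ (.idL (by simpa using hT) rfl) _ (.negR hd)
    · exact hD _ (.idR (by simpa using hT) rfl) _ (Derivable.swap hd)
    · exact absurd rfl hS₀
  | @closing x h U =>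
    intro T hT hU
    rcases Multiset.cons_eq_add hU with ⟨S', rfl, -⟩ | ⟨T', rfl, -⟩
    · exact hD _ (.closing h (by simp)) _ (.closing .topR _)
    · exact (Derivable.closing h _).swap
  | @unit x h =>
    intro T hT hU
    have hd : Derivable weak M {x} := .unit h
    rcases Multiset.cons_eq_add (U := 0) hU with ⟨S', rfl, h₁⟩ | ⟨T', rfl, h₁⟩ <;>
    obtain ⟨rfl, rfl⟩ := add_eq_zero.1 h₁.symm
    · exact hD _ (.derivable hd) _ (.unit .oneR)
    · exact absurd rfl hS₀
  | @unary x α U h hU' ih =>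
    intro T hT hU
    rcases Multiset.cons_eq_add hU with ⟨S', rfl, rfl⟩ | ⟨T', rfl, rfl⟩
    · have hI := hA (α + S') (by have := h.weight_lt; simp; omega)
      exact hD _ (.unary h rfl) _ (hI.right T hT (by simpa [add_assoc] using hU'))
    · rw [free_cons] at hT
      have := ih (α + T') (free_add.2 ⟨h.free hT.1, hT.2⟩) (by abel)
      exact Derivable.swap (.unary h (by simpa using this))
  | @additive x y z U h h₁ h₂ ih₁ ih₂ =>
    intro T hT hU
    rcases Multiset.cons_eq_add hU with ⟨S', rfl, rfl⟩ | ⟨T', rfl, rfl⟩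
    · have hy := hA (y ::ₘ S') (by have := h.size_lt; simp; omega)
      have hz := hA (z ::ₘ S') (by have := h.size_lt; simp; omega)
      exact hD _ (.additive h rfl) _ (.additive (.andR _ _)
        (hy.right T hT (by simpa using h₁)) (hz.right T hT (by simpa using h₂)))
    · rw [free_cons] at hT
      have hf := h.free hT.1
      exact Derivable.swap (.additive h
        (ih₁ (y ::ₘ T') (free_cons.2 ⟨hf.1, hT.2⟩) (by simp)).swap
        (ih₂ (z ::ₘ T') (free_cons.2 ⟨hf.2, hT.2⟩) (by simp)).swap)
  | @multiplicative x y z U V h h₁ h₂ ih₁ ih₂ =>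
    intro T hT hU
    rcases Multiset.cons_eq_add hU with ⟨S', rfl, hV⟩ | ⟨T', rfl, hV⟩
    · obtain ⟨S₁, S₂, T₁, T₂, rfl, rfl, rfl, rfl⟩ := Multiset.exists_refinement_of_add_eq_add hV
      have hy := hA (y ::ₘ S₁) (by have := h.size_lt; simp; omega)
      have hz := hA (z ::ₘ S₂) (by have := h.size_lt; simp; omega)
      rw [free_add] at hT
      exact hD _ (.multiplicative h rfl) _ (.multiplicative (.fusR _ _)
        (hy.right T₁ hT.1 (by simpa using h₁)) (hz.right T₂ hT.2 (by simpa using h₂)))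
    · obtain ⟨S₁, S₂, T₁, T₂, rfl, rfl, rfl, rfl⟩ := Multiset.exists_refinement_of_add_eq_add hV
      rw [free_cons, free_add] at hT
      obtain ⟨hx, hT₁, hT₂⟩ := hT
      have hf := h.free hx
      -- If one part of `S` is empty, the other premise contains all of `S` and the recursion on
      -- size gives nothing. That premise is handled by the induction hypothesis instead, and the
      -- inference is repeated below `D`.
      by_cases hS₁ : S₁ = 0
      · subst hS₁
        have := ih₂ (z ::ₘ T₂) (free_cons.2 ⟨hf.2, hT₂⟩) (by simp)
        have := Derivable.multiplicative h (S := T₁) (by simpa using h₁) this.swap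
        simpa using Derivable.swap (by simpa using this)
      by_cases hS₂ : S₂ = 0
      · subst hS₂
        have := ih₁ (y ::ₘ T₁) (free_cons.2 ⟨hf.1, hT₁⟩) (by simp)
        have := Derivable.multiplicative h (T := T₂) this.swap (by simpa using h₂)
        simpa using Derivable.swap (by simpa using this)
      have hy := (hA S₁ (by have := weight_pos hS₂; simp; omega)).right (y ::ₘ T₁)
        (free_cons.2 ⟨hf.1, hT₁⟩) (by simpa using h₁)
      have hz := (hA S₂ (by have := weight_pos hS₁; simp; omega)).right (z ::ₘ T₂)
        (free_cons.2 ⟨hf.2, hT₂⟩) (by simpa using h₂)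
      refine hD _ (.split hS₁ hS₂ rfl) _ (.unary (.addR _ _) ?_)
      convert Derivable.multiplicative h hy.swap hz.swap using 1
      simp only [Multiset.insert_eq_cons, ← Multiset.singleton_add]
      abel
  | @ruleK Γ φ b h h₁ _ =>
    intro T hT hU
    rcases Multiset.cons_eq_add hU with ⟨S', rfl, hV⟩ | ⟨T', rfl, hV⟩
    · obtain ⟨Γ₁, Γ₂, rfl, rfl, rfl⟩ := Multiset.exists_of_map_eq_add hV
      have hI := hA (.inr φ ::ₘ Γ₁.map .inl) (by simp [size_box, weight_map_inl_box]; omega)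
      exact hD _ (.box h rfl) _ (.ruleK b h
        (hI.right _ (free_map_inl_box hT) (by simpa using h₁)))
    · obtain ⟨Γ₁, Γ₂, rfl, rfl, rfl⟩ := Multiset.exists_of_map_eq_add hV
      rw [free_cons] at hT
      have hI := hA (Γ₁.map .inl) (weight_map_inl_lt hS₀)
      have := hI.right (.inr φ ::ₘ Γ₂.map .inl)
        (free_cons.2 ⟨by simpa [vars_box] using hT.1, free_map_inl_box hT.2⟩) (by simpa using h₁)
      -- Here `S = □Γ₁`, and the smaller interpolant gives `Γ₂ ⇒ A, φ`. Moving `A` across as `¬A`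
      -- leaves a single succedent formula, as `K` requires.
      refine hD _ (.diamond h rfl) _ (.negR ?_)
      have := Derivable.ruleK (Γ := _ ::ₘ Γ₂) b h (by simpa using this.negL.swap)
      exact Derivable.swap (by simpa using this)
  | @ruleD Γ b h h₁ _ =>
    intro T hT hU
    obtain ⟨Γ₁, Γ₂, rfl, rfl, rfl⟩ := Multiset.exists_of_map_eq_add hU
    have hI := hA (Γ₁.map .inl) (weight_map_inl_lt hS₀)
    have := hI.right (Γ₂.map .inl) (free_map_inl_box hT) (by simpa using h₁)
    refine hD _ (.diamond (ModalVersion.hasK_of_hasD h) rfl) _ (.negR ?_)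
    simpa using Derivable.ruleD (Γ := _ ::ₘ Γ₂) b h (by simpa using this.negL)

theorem exists_isInterpolant (weak : Prop) (M : ModalVersion σ) (p : Atom) (n : ℕ) :
    ∀ S : Multiset (Signed Atom σ), weight S = n → ∃ A, IsInterpolant weak M p S A := by
  induction n using Nat.strong_induction_on with
  | _ n ih =>
    rintro S rfl
    -- The empty sequent is interpolated by `0` directly, since unboxing it would not lower the
    -- weight.
    by_cases hS₀ : S = 0
    · subst hS₀
      exact ⟨zero, by simp [vars], .unit .zeroL,
        fun T _ h => .unary .zeroR (by simpa using h)⟩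
    have ih' : ∀ S', weight S' < weight S → ∃ A, IsInterpolant weak M p S' A :=
      fun S' h => ih _ h S' rfl
    have : Nonempty (SubFormula Atom σ) := ⟨top⟩
    choose! A hA using ih'
    obtain ⟨D, hp, hl, hr⟩ := exists_disjunction (Disjunct.finite weak M p A S)
      fun B hB => Disjunct.sound hS₀ hA hB
    exact ⟨D, hp, hl, fun T hT h => h.complete hS₀ hA hr T hT rfl⟩

/-- A derivation of a single implication in the succedent can only end with the right rule for `→`
or with weakening. In the latter case the empty sequent is derivable and is weakened by both
components. -/
theorem Derivable.imp_inv {φ ψ : SubFormula Atom σ}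
    (h : Derivable weak M {.inr (imp φ ψ)}) : Derivable weak M {.inl φ, .inr ψ} := by
  generalize hU : ({.inr (imp φ ψ)} : Multiset (Signed Atom σ)) = U at h
  cases h with
  | id χ => simpa using congrArg Multiset.card hU
  | closing h S =>
    obtain ⟨rfl, -⟩ := Multiset.eq_of_cons_eq_singleton hU.symm
    cases h
  | unit h =>
    rw [Multiset.singleton_inj] at hU
    subst hU
    cases h
  | unary h h₁ =>
    obtain ⟨rfl, rfl⟩ := Multiset.eq_of_cons_eq_singleton hU.symm
    cases h with
    | weaken h => exact .unary (.weaken h _) (.unary (.weaken h _) h₁)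
    | impR => exact h₁
  | additive h =>
    obtain ⟨rfl, -⟩ := Multiset.eq_of_cons_eq_singleton hU.symm
    cases h
  | multiplicative h =>
    obtain ⟨rfl, -⟩ := Multiset.eq_of_cons_eq_singleton hU.symm
    cases h
  | ruleK b =>
    have := (Multiset.eq_of_cons_eq_singleton hU.symm).1
    simp [SubFormula.box] at this
  | ruleD b =>
    have := hU ▸ Multiset.mem_singleton_self (.inr (imp φ ψ) : Signed Atom σ)
    simp at this

end Signed

variable {Atom : Type u} {σ : Signature.{v}}

theorem derives_iff_derivable {weak : Prop} {M : ModalVersion σ} {φ : SubFormula Atom σ} :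
    Derives weak M 0 {φ} ↔ Signed.Derivable weak M {.inr φ} :=
  ⟨fun h => h.oneSided, fun h => h.derives⟩

theorem uniformInterpolation (weak : Prop) (M : ModalVersion σ) :
    UniformInterpolation {φ : SubFormula Atom σ | Derives weak M 0 {φ}} := by
  intro φ p
  obtain ⟨A, hA⟩ := Signed.exists_isInterpolant weak M p _ {.inr φ} rfl
  obtain ⟨E, hE⟩ := Signed.exists_isInterpolant weak M p _ {.inl φ} rfl
  simp only [Set.mem_ofPred_eq, derives_iff_derivable]
  -- `E` comes from `φ` in the antecedent, so `E, φ ⇒` is derivable, and `φ ⇒ ψ` yields `⇒ E, ψ`;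
  -- hence its negation is the post-interpolant.
  refine ⟨A, imp E zero, hA.free, by simp [vars, hE.free], ?_, ?_, ?_, ?_⟩
  · exact .impR (T := 0) hA.left
  · intro ψ hψ h
    exact .impR (T := 0)
      (Signed.Derivable.swap (hA.right {.inl ψ} (by simpa using hψ) h.imp_inv.swap))
  · exact .impR (T := 0) (Signed.Derivable.swap hE.left.negR)
  · intro ψ hψ h
    exact .impR (T := 0) (hE.right {.inr ψ} (by simpa using hψ) h.imp_inv).negL

end SubFormula

/-! ### Classical formulas, a set-based calculus, and inversion of its rules. -/

namespace ClFormula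

variable {Atom : Type u} {σ : Signature.{v}} {M : ModalVersion σ} {p : Atom}

/-- The number of connectives and atoms in a formula. -/
def size : ClFormula Atom σ → ℕ
  | atom _ => 1
  | top => 1
  | bot => 1
  | and φ ψ => φ.size + ψ.size + 1
  | or φ ψ => φ.size + ψ.size + 1
  | imp φ ψ => φ.size + ψ.size + 1
  | app _ φ => (∑ i, (φ i).size) + 1

theorem size_pos (φ : ClFormula Atom σ) : 0 < φ.size := by
  cases φ <;> simp [size]

theorem size_box (b : σ.Unary) (φ : ClFormula Atom σ) : (box b φ).size = φ.size + 1 := by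
  obtain ⟨c, hc⟩ := b
  simp [box, size, hc]

theorem vars_box (b : σ.Unary) (φ : ClFormula Atom σ) : (box b φ).vars = φ.vars := by
  obtain ⟨c, hc⟩ := b
  have : Nonempty (Fin (σ.arity c)) := ⟨⟨0, by omega⟩⟩
  simp [box, vars, Set.iUnion_const]

theorem box_injective (b : σ.Unary) : Function.Injective (box (Atom := Atom) b) := by
  intro φ ψ h
  obtain ⟨c, hc⟩ := b
  have : Nonempty (Fin (σ.arity c)) := ⟨⟨0, by omega⟩⟩
  simp only [box, app.injEq, heq_eq_eq, true_and] at h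
  exact congrFun h (Classical.arbitrary _)

/-- Presents the removal of `□` as a partial function, which can then be used to filter multisets.
-/
theorem partialInv_box {b : σ.Unary} {φ ψ : ClFormula Atom σ} :
    Function.partialInv (box b) ψ = some φ ↔ box b φ = ψ :=
  (box_injective b).isPartialInv _ _

/-- Formulas with a side: `inl φ` stands for `φ` in the antecedent and `inr φ` for `φ` in the
succedent of a sequent. -/
abbrev Signed (Atom : Type u) (σ : Signature.{v}) := ClFormula Atom σ ⊕ ClFormula Atom σ

namespace Signed

/-- The underlying formula of a signed formula. -/
def form : Signed Atom σ → ClFormula Atom σ := Sum.elim id id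

@[simp] theorem form_inl (φ : ClFormula Atom σ) : form (.inl φ) = φ := rfl

@[simp] theorem form_inr (φ : ClFormula Atom σ) : form (.inr φ) = φ := rfl

/-- Signed formulas that make every sequent they occur in an axiom. -/
inductive Closing : Signed Atom σ → Prop
  | topR : Closing (.inr top)
  | botL : Closing (.inl bot)

/-- `Alpha x y z`: a rule infers `x, S` from `y, z, S`. -/
inductive Alpha : Signed Atom σ → Signed Atom σ → Signed Atom σ → Prop
  | andL (φ ψ) : Alpha (.inl (and φ ψ)) (.inl φ) (.inl ψ)
  | orR (φ ψ) : Alpha (.inr (or φ ψ)) (.inr φ) (.inr ψ)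
  | impR (φ ψ) : Alpha (.inr (imp φ ψ)) (.inl φ) (.inr ψ)

/-- `Beta x y z`: a rule infers `x, S` from `y, S` and `z, S`. -/
inductive Beta : Signed Atom σ → Signed Atom σ → Signed Atom σ → Prop
  | andR (φ ψ) : Beta (.inr (and φ ψ)) (.inr φ) (.inr ψ)
  | orL (φ ψ) : Beta (.inl (or φ ψ)) (.inl φ) (.inl ψ)
  | impL (φ ψ) : Beta (.inl (imp φ ψ)) (.inr φ) (.inl ψ)

theorem Alpha.size_lt {x y z : Signed Atom σ} (h : Alpha x y z) :
    y.form.size + z.form.size < x.form.size := by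
  cases h <;> simp [size]

theorem Beta.size_lt {x y z : Signed Atom σ} (h : Beta x y z) :
    y.form.size < x.form.size ∧ z.form.size < x.form.size := by
  cases h <;> simp [size]

theorem Alpha.free {x y z : Signed Atom σ} (h : Alpha x y z) (hp : p ∉ x.form.vars) :
    p ∉ y.form.vars ∧ p ∉ z.form.vars := by
  cases h <;> simp_all [vars]

theorem Beta.free {x y z : Signed Atom σ} (h : Beta x y z) (hp : p ∉ x.form.vars) :
    p ∉ y.form.vars ∧ p ∉ z.form.vars := by
  cases h <;> simp_all [vars]

/-- Changing sides turns conjunctive decomposition into disjunctive decomposition; this duality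
halves the case analysis for identity axioms. -/
theorem Alpha.swap {x y z : Signed Atom σ} (h : Alpha x y z) : Beta x.swap y.swap z.swap := by
  cases h <;> constructor

theorem Beta.swap {x y z : Signed Atom σ} (h : Beta x y z) : Alpha x.swap y.swap z.swap := by
  cases h <;> constructor

theorem Alpha.unique {x y z y' z' : Signed Atom σ} (h : Alpha x y z) (h' : Alpha x y' z') :
    y = y' ∧ z = z' := by
  cases h <;> cases h' <;> exact ⟨rfl, rfl⟩

theorem Beta.unique {x y z y' z' : Signed Atom σ} (h : Beta x y z) (h' : Beta x y' z') :
    y = y' ∧ z = z' := by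
  cases h <;> cases h' <;> exact ⟨rfl, rfl⟩

theorem Alpha.not_beta {x y z y' z' : Signed Atom σ} (h : Alpha x y z) : ¬ Beta x y' z' := by
  intro h'
  cases h <;> cases h'

/-- The antecedent obtained from the boxed formulas in the antecedent of `S` by removing `□`. -/
def unbox (b : σ.Unary) (S : Set (Signed Atom σ)) : Set (Signed Atom σ) :=
  {x | ∃ φ, x = .inl φ ∧ .inl (box b φ) ∈ S}

@[gcongr] theorem unbox_mono {b : σ.Unary} {S S' : Set (Signed Atom σ)} (h : S ⊆ S') :
    unbox b S ⊆ unbox b S' := by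
  rintro _ ⟨φ, rfl, hφ⟩
  exact ⟨φ, rfl, h hφ⟩

/-- Derivability of one-sided sequents, that is, sets of signed formulas, in a classical calculus
whose rules keep their principal formulas. -/
inductive Derivable (M : ModalVersion σ) : Set (Signed Atom σ) → Prop
  | id {S φ} (hl : .inl φ ∈ S) (hr : .inr φ ∈ S) : Derivable M S
  | closing {S x} (h : Closing x) (hx : x ∈ S) : Derivable M S
  | alpha {S x y z} (h : Alpha x y z) (hx : x ∈ S) :
      Derivable M (insert y (insert z S)) → Derivable M S
  | beta {S x y z} (h : Beta x y z) (hx : x ∈ S) :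
      Derivable M (insert y S) → Derivable M (insert z S) → Derivable M S
  | ruleK {S φ} (b : σ.Unary) (h : M.HasK b) (hx : .inr (box b φ) ∈ S) :
      Derivable M (insert (.inr φ) (unbox b S)) → Derivable M S
  | ruleD {S} (b : σ.Unary) (h : M.HasD b) : Derivable M (unbox b S) → Derivable M S

/-- The signed formula `x` occurs in `S`, or enough of its components do to replace it. -/
inductive Covers (S : Set (Signed Atom σ)) (x : Signed Atom σ) : Prop
  | mem (h : x ∈ S)
  | alpha {y z} (h : Alpha x y z) (hy : y ∈ S) (hz : z ∈ S)
  | beta₁ {y z} (h : Beta x y z) (hy : y ∈ S)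
  | beta₂ {y z} (h : Beta x y z) (hz : z ∈ S)

theorem Covers.mono {S S' : Set (Signed Atom σ)} (h : S ⊆ S') {x : Signed Atom σ}
    (hx : Covers S x) : Covers S' x := by
  cases hx with
  | mem hx => exact .mem (h hx)
  | alpha hα hy hz => exact .alpha hα (h hy) (h hz)
  | beta₁ hβ hy => exact .beta₁ hβ (h hy)
  | beta₂ hβ hz => exact .beta₂ hβ (h hz)

/-- No propositional rule decomposes a boxed formula, so covering it means containing it; inversion
therefore does not interfere with the modal rules. -/
theorem Covers.inl_box {S : Set (Signed Atom σ)} {b : σ.Unary} {φ : ClFormula Atom σ}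
    (h : Covers S (.inl (box b φ))) : .inl (box b φ) ∈ S := by
  rcases h with h | h | h | h
  · exact h
  all_goals cases h

theorem Covers.inr_box {S : Set (Signed Atom σ)} {b : σ.Unary} {φ : ClFormula Atom σ}
    (h : Covers S (.inr (box b φ))) : .inr (box b φ) ∈ S := by
  rcases h with h | h | h | h
  · exact h
  all_goals cases h

theorem Derivable.of_mem_swap {S : Set (Signed Atom σ)} {x : Signed Atom σ} (h : x ∈ S)
    (h' : x.swap ∈ S) : Derivable M S := by
  cases x with
  | inl φ => exact .id h h'
  | inr φ => exact .id h' h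

theorem Derivable.of_mem_covers {S : Set (Signed Atom σ)} {x : Signed Atom σ} (h : x ∈ S)
    (h' : Covers S x.swap) : Derivable M S := by
  cases h' with
  | mem h' => exact .of_mem_swap h h'
  | @alpha y z hα hy hz =>
    have hβ := hα.swap
    rw [Sum.swap_swap] at hβ
    exact .beta hβ h (.of_mem_swap (x := y) (by simp [hy]) (by simp))
      (.of_mem_swap (x := z) (by simp [hz]) (by simp))
  | @beta₁ y z hβ hy =>
    have hα := hβ.swap
    rw [Sum.swap_swap] at hα
    exact .alpha hα h (.of_mem_swap (x := y) (by simp [hy]) (by simp))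
  | @beta₂ y z hβ hz =>
    have hα := hβ.swap
    rw [Sum.swap_swap] at hα
    exact .alpha hα h (.of_mem_swap (x := z) (by simp [hz]) (by simp))

/-- Identity axioms for compound formulas survive inversion: whatever components replace the two
copies, dual rules lead back to complementary formulas. -/
theorem Derivable.of_covers_swap {S : Set (Signed Atom σ)} {x : Signed Atom σ} (h : Covers S x)
    (h' : Covers S x.swap) : Derivable M S := by
  cases h with
  | mem h => exact .of_mem_covers h h'
  | @alpha y z hα hy hz =>
    cases h' with
    | mem h' => exact .of_mem_covers h' (by rw [Sum.swap_swap]; exact .alpha hα hy hz)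
    | alpha hα' => exact absurd hα.swap hα'.not_beta
    | beta₁ hβ hy' =>
      obtain ⟨rfl, rfl⟩ := hα.swap.unique hβ
      exact .of_mem_swap hy hy'
    | beta₂ hβ hz' =>
      obtain ⟨rfl, rfl⟩ := hα.swap.unique hβ
      exact .of_mem_swap hz hz'
  | @beta₁ y z hβ hy =>
    cases h' with
    | mem h' => exact .of_mem_covers h' (by rw [Sum.swap_swap]; exact .beta₁ hβ hy)
    | alpha hα hy' hz' =>
      obtain ⟨rfl, rfl⟩ := hβ.swap.unique hα
      exact .of_mem_swap hy hy'
    | beta₁ hβ' => exact absurd hβ' hβ.swap.not_beta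
    | beta₂ hβ' => exact absurd hβ' hβ.swap.not_beta
  | @beta₂ y z hβ hz =>
    cases h' with
    | mem h' => exact .of_mem_covers h' (by rw [Sum.swap_swap]; exact .beta₂ hβ hz)
    | alpha hα hy' hz' =>
      obtain ⟨rfl, rfl⟩ := hβ.swap.unique hα
      exact .of_mem_swap hz hz'
    | beta₁ hβ' => exact absurd hβ' hβ.swap.not_beta
    | beta₂ hβ' => exact absurd hβ' hβ.swap.not_beta

theorem covers_insert {S S' : Set (Signed Atom σ)} (h : ∀ x ∈ S, Covers S' x)
    (y : Signed Atom σ) : ∀ x ∈ insert y S, Covers (insert y S') x := by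
  rintro x (rfl | hx)
  · exact .mem (.inl rfl)
  · exact (h x hx).mono (Set.subset_insert _ _)

theorem covers_insert_of_mem {S S' : Set (Signed Atom σ)} (h : ∀ x ∈ S, Covers S' x)
    {y : Signed Atom σ} (hy : y ∈ S') : ∀ x ∈ insert y S, Covers S' x := by
  rintro x (rfl | hx)
  · exact .mem hy
  · exact h x hx

theorem unbox_subset_of_covers {S S' : Set (Signed Atom σ)} (h : ∀ x ∈ S, Covers S' x)
    (b : σ.Unary) : ∀ x ∈ unbox b S, Covers (unbox b S') x := by
  rintro _ ⟨φ, rfl, hφ⟩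
  exact .mem ⟨φ, rfl, (h _ hφ).inl_box⟩

/-- Weakening and the invertibility of the propositional rules. -/
theorem Derivable.of_covers {S : Set (Signed Atom σ)} (hS : Derivable M S) :
    ∀ S', (∀ x ∈ S, Covers S' x) → Derivable M S' := by
  induction hS with
  | id hl hr => exact fun S' h => .of_covers_swap (h _ hl) (h _ hr)
  | closing h hx =>
    intro S' hS'
    rcases hS' _ hx with hx | hα | hβ | hβ
    · exact .closing h hx
    · cases h <;> cases hα
    · cases h <;> cases hβ
    · cases h <;> cases hβ
  | alpha h hx _ ih =>
    intro S' hS'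
    rcases hS' _ hx with hx | ⟨hα, hy, hz⟩ | hβ | hβ
    · exact .alpha h hx (ih _ (covers_insert (covers_insert hS' _) _))
    -- Rules are determined by their principal formula, so the components in `S'` are those of the
    -- premise and the inference is simply dropped.
    · obtain ⟨rfl, rfl⟩ := h.unique hα
      exact ih _ (covers_insert_of_mem (covers_insert_of_mem hS' hz) hy)
    · exact absurd hβ h.not_beta
    · exact absurd hβ h.not_beta
  | beta h hx _ _ ih₁ ih₂ =>
    intro S' hS'
    rcases hS' _ hx with hx | hα | ⟨hβ, hy⟩ | ⟨hβ, hz⟩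
    · exact .beta h hx (ih₁ _ (covers_insert hS' _)) (ih₂ _ (covers_insert hS' _))
    · exact absurd h hα.not_beta
    · obtain ⟨rfl, rfl⟩ := h.unique hβ
      exact ih₁ _ (covers_insert_of_mem hS' hy)
    · obtain ⟨rfl, rfl⟩ := h.unique hβ
      exact ih₂ _ (covers_insert_of_mem hS' hz)
  | ruleK b h hx _ ih =>
    exact fun S' hS' => .ruleK b h (hS' _ hx).inr_box
      (ih _ (covers_insert (unbox_subset_of_covers hS' b) _))
  | ruleD b h _ ih => exact fun S' hS' => .ruleD b h (ih _ (unbox_subset_of_covers hS' b))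

theorem Derivable.mono {S S' : Set (Signed Atom σ)} (hS : Derivable M S) (h : S ⊆ S') :
    Derivable M S' :=
  hS.of_covers S' fun _ hx => .mem (h hx)

end Signed

/-! ### Translation between the classical calculus on multisets and the set-based one. -/

open Signed

/-- The one-sided version of the sequent `Γ ⇒ Δ`. -/
def oneSided (Γ Δ : Multiset (ClFormula Atom σ)) : Set (Signed Atom σ) :=
  {x | Sum.elim (· ∈ Γ) (· ∈ Δ) x}

@[simp] theorem inl_mem_oneSided {Γ Δ : Multiset (ClFormula Atom σ)} {φ : ClFormula Atom σ} :
    .inl φ ∈ oneSided Γ Δ ↔ φ ∈ Γ := Iff.rfl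

@[simp] theorem inr_mem_oneSided {Γ Δ : Multiset (ClFormula Atom σ)} {φ : ClFormula Atom σ} :
    .inr φ ∈ oneSided Γ Δ ↔ φ ∈ Δ := Iff.rfl

theorem Derives.oneSided {Γ Δ : Multiset (ClFormula Atom σ)} (h : Derives M Γ Δ) :
    Derivable M (oneSided Γ Δ) := by
  induction h with
  | id φ => exact .id (φ := φ) (by simp) (by simp)
  | topR Γ Δ => exact .closing .topR (by simp)
  | botL Γ Δ => exact .closing .botL (by simp)
  | @andL₁ Γ Δ φ ψ _ ih =>
    refine .alpha (.andL φ ψ) (by simp) (ih.mono ?_)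
    rintro (χ | χ) <;> simp
    tauto
  | @andL₂ Γ Δ ψ φ _ ih =>
    refine .alpha (.andL φ ψ) (by simp) (ih.mono ?_)
    rintro (χ | χ) <;> simp
    tauto
  | @andR Γ Δ φ ψ _ _ ih₁ ih₂ =>
    refine .beta (.andR φ ψ) (by simp) (ih₁.mono ?_) (ih₂.mono ?_) <;>
    rintro (χ | χ) <;> simp <;> tauto
  | @orL Γ Δ φ ψ _ _ ih₁ ih₂ =>
    refine .beta (.orL φ ψ) (by simp) (ih₁.mono ?_) (ih₂.mono ?_) <;>
    rintro (χ | χ) <;> simp <;> tauto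
  | @orR₁ Γ Δ φ ψ _ ih =>
    refine .alpha (.orR φ ψ) (by simp) (ih.mono ?_)
    rintro (χ | χ) <;> simp
    tauto
  | @orR₂ Γ Δ ψ φ _ ih =>
    refine .alpha (.orR φ ψ) (by simp) (ih.mono ?_)
    rintro (χ | χ) <;> simp
    tauto
  | @impL Γ Θ Δ Λ φ ψ _ _ ih₁ ih₂ =>
    refine .beta (.impL φ ψ) (by simp) (ih₁.mono ?_) (ih₂.mono ?_) <;>
    rintro (χ | χ) <;> simp <;> tauto
  | @impR Γ Δ φ ψ _ ih =>
    refine .alpha (.impR φ ψ) (by simp) (ih.mono ?_)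
    rintro (χ | χ) <;> simp
    tauto
  | weakL φ _ ih =>
    refine ih.mono ?_
    rintro (χ | χ) <;> simp
    tauto
  | weakR φ _ ih =>
    refine ih.mono ?_
    rintro (χ | χ) <;> simp
    tauto
  | contrL _ ih =>
    refine ih.mono ?_
    rintro (χ | χ) <;> simp
  | contrR _ ih =>
    refine ih.mono ?_
    rintro (χ | χ) <;> simp
  | @ruleK Γ φ b h _ ih =>
    refine .ruleK (φ := φ) b h (by simp) (ih.mono ?_)
    rintro (χ | χ) hχ
    · exact .inr ⟨χ, rfl, by simpa using ⟨χ, hχ, rfl⟩⟩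
    · exact .inl (by simpa using hχ)
  | @ruleD Γ b h _ ih =>
    refine .ruleD b h (ih.mono ?_)
    rintro (χ | χ) hχ
    · exact ⟨χ, rfl, by simpa using ⟨χ, hχ, rfl⟩⟩
    · simp at hχ

theorem Derives.weaken {Γ Δ : Multiset (ClFormula Atom σ)} (h : Derives M Γ Δ)
    (Γ' Δ' : Multiset (ClFormula Atom σ)) : Derives M (Γ + Γ') (Δ + Δ') := by
  induction Γ' using Multiset.induction_on with
  | empty =>
    induction Δ' using Multiset.induction_on with
    | empty => simpa using h
    | cons φ Δ' ih => simpa using ih.weakR φ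
  | cons φ Γ' ih => simpa using ih.weakL φ

theorem Derives.contract {Γ Δ Γ' Δ' : Multiset (ClFormula Atom σ)}
    (h : Derives M (Γ + Γ') (Δ + Δ')) (hΓ : Γ ⊆ Γ') (hΔ : Δ ⊆ Δ') : Derives M Γ' Δ' := by
  induction Γ using Multiset.induction_on with
  | empty =>
    rw [zero_add] at h
    induction Δ using Multiset.induction_on with
    | empty => simpa using h
    | cons φ Δ ih =>
      obtain ⟨hφ, hΔ⟩ := Multiset.cons_subset.1 hΔ
      refine ih hΔ ?_
      obtain ⟨Δ'', rfl⟩ := Multiset.exists_cons_of_mem hφ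
      have := contrR (Γ := Γ') (Δ := Δ + Δ'') (φ := φ) (by simpa using h)
      simpa using this
  | cons φ Γ ih =>
    obtain ⟨hφ, hΓ⟩ := Multiset.cons_subset.1 hΓ
    refine ih ?_ hΓ
    obtain ⟨Γ'', rfl⟩ := Multiset.exists_cons_of_mem hφ
    have := contrL (Γ := Γ + Γ'') (Δ := Δ + Δ') (φ := φ) (by simpa using h)
    simpa using this

/-- Weakening and contraction together make derivability depend only on which formulas occur, not on
how often. -/
theorem Derives.of_subset {Γ Δ Γ' Δ' : Multiset (ClFormula Atom σ)} (h : Derives M Γ Δ)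
    (hΓ : Γ ⊆ Γ') (hΔ : Δ ⊆ Δ') : Derives M Γ' Δ' :=
  (h.weaken Γ' Δ').contract hΓ hΔ

theorem insert_inl_subset_oneSided {S : Set (Signed Atom σ)} {Γ Δ : Multiset (ClFormula Atom σ)}
    (h : S ⊆ ClFormula.oneSided Γ Δ) (φ : ClFormula Atom σ) :
    insert (.inl φ) S ⊆ ClFormula.oneSided (φ ::ₘ Γ) Δ := by
  rintro (χ | χ) hχ
  · rcases hχ with hχ | hχ
    · simp_all
    · exact Multiset.mem_cons_of_mem (h hχ)
  · rcases hχ with hχ | hχ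
    · simp at hχ
    · exact h hχ

theorem insert_inr_subset_oneSided {S : Set (Signed Atom σ)} {Γ Δ : Multiset (ClFormula Atom σ)}
    (h : S ⊆ ClFormula.oneSided Γ Δ) (φ : ClFormula Atom σ) :
    insert (.inr φ) S ⊆ ClFormula.oneSided Γ (φ ::ₘ Δ) := by
  rintro (χ | χ) hχ
  · rcases hχ with hχ | hχ
    · simp at hχ
    · exact h hχ
  · rcases hχ with hχ | hχ
    · simp_all
    · exact Multiset.mem_cons_of_mem (h hχ)

theorem unbox_subset_oneSided {S : Set (Signed Atom σ)} {Γ Δ : Multiset (ClFormula Atom σ)}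
    (h : S ⊆ ClFormula.oneSided Γ Δ) (b : σ.Unary) :
    unbox b S ⊆ ClFormula.oneSided (Γ.filterMap (Function.partialInv (box b))) 0 := by
  rintro _ ⟨φ, rfl, hφ⟩
  exact (Multiset.mem_filterMap _ _).2 ⟨_, h hφ, partialInv_box.2 rfl⟩

theorem map_box_filterMap_subset (b : σ.Unary) (Γ : Multiset (ClFormula Atom σ)) :
    (Γ.filterMap (Function.partialInv (box b))).map (box b) ⊆ Γ := by
  intro φ hφ
  obtain ⟨ψ, hψ, rfl⟩ := Multiset.mem_map.1 hφ
  obtain ⟨χ, hχ, h⟩ := (Multiset.mem_filterMap _ _).1 hψ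
  rwa [partialInv_box.1 h]

/-- A set has no canonical multiset, so the claim is made for all multisets that contain it. Each
rule adds a further copy of a principal formula already present, and `Derives.of_subset` contracts
it away. -/
theorem Signed.Derivable.derives {S : Set (Signed Atom σ)} (h : Derivable M S) :
    ∀ Γ Δ, S ⊆ ClFormula.oneSided Γ Δ → Derives M Γ Δ := by
  induction h with
  | @id S φ hl hr =>
    exact fun Γ Δ h => (Derives.id φ).of_subset (by simpa using h hl) (by simpa using h hr)
  | closing hc hx =>
    intro Γ Δ h
    have := h hx
    cases hc with
    | topR => exact (Derives.topR Γ Δ).of_subset (by simp) (by simpa using this)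
    | botL => exact (Derives.botL Γ Δ).of_subset (by simpa using this) (by simp)
  | alpha hα hx _ ih =>
    intro Γ Δ h
    have hmem := h hx
    cases hα with
    | andL φ ψ =>
      have := ih _ _ (insert_inl_subset_oneSided (insert_inl_subset_oneSided h ψ) φ)
      have := (Multiset.cons_swap _ _ _ ▸ this.andL₁ ψ).andL₂ φ
      exact this.of_subset (by simpa using hmem) (by simp)
    | orR φ ψ =>
      have := ih _ _ (insert_inr_subset_oneSided (insert_inr_subset_oneSided h ψ) φ)
      have := (Multiset.cons_swap _ _ _ ▸ this.orR₁ ψ).orR₂ φ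
      exact this.of_subset (by simp) (by simpa using hmem)
    | impR φ ψ =>
      have := ih _ _ (insert_inl_subset_oneSided (insert_inr_subset_oneSided h ψ) φ)
      exact this.impR.of_subset (by simp) (by simpa using hmem)
  | beta hβ hx _ _ ih₁ ih₂ =>
    intro Γ Δ h
    have hmem := h hx
    cases hβ with
    | andR φ ψ =>
      have := (ih₁ _ _ (insert_inr_subset_oneSided h φ)).andR
        (ih₂ _ _ (insert_inr_subset_oneSided h ψ))
      exact this.of_subset (by simp) (by simpa using hmem)
    | orL φ ψ =>
      have := (ih₁ _ _ (insert_inl_subset_oneSided h φ)).orL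
        (ih₂ _ _ (insert_inl_subset_oneSided h ψ))
      exact this.of_subset (by simpa using hmem) (by simp)
    | impL φ ψ =>
      have := (ih₁ _ _ (insert_inr_subset_oneSided h φ)).impL
        (ih₂ _ _ (insert_inl_subset_oneSided h ψ))
      refine this.of_subset ?_ ?_
      · intro χ hχ
        simp only [Multiset.mem_cons, Multiset.mem_add, or_self] at hχ
        rcases hχ with rfl | hχ
        · exact hmem
        · exact hχ
      · intro χ hχ
        simpa using hχ
  | @ruleK S φ b hK hx _ ih =>
    intro Γ Δ h
    have := ih _ _ (insert_inr_subset_oneSided (unbox_subset_oneSided h b) φ)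
    exact (Derives.ruleK b hK this).of_subset (map_box_filterMap_subset b Γ) (by simpa using h hx)
  | @ruleD S b hD _ ih =>
    intro Γ Δ h
    have := ih _ _ (unbox_subset_oneSided h b)
    exact (Derives.ruleD b hD this).of_subset (map_box_filterMap_subset b Γ) (by simp)

theorem derives_iff_derivable {φ : ClFormula Atom σ} :
    Derives M 0 {φ} ↔ Derivable M {.inr φ} := by
  refine ⟨fun h => h.oneSided.mono ?_, fun h => h.derives _ _ ?_⟩
  · rintro (χ | χ) <;> simp
  · simp

end ClFormula

/-! ### Uniform interpolants for the classical calculi. -/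

namespace ClFormula

variable {Atom : Type u} {σ : Signature.{v}} {M : ModalVersion σ} {p : Atom}

namespace Signed

/-- The atom `p` does not occur in the sequent `S`. -/
def Free (p : Atom) (S : Set (Signed Atom σ)) : Prop := ∀ x ∈ S, p ∉ x.form.vars

theorem Free.insert {S : Set (Signed Atom σ)} (h : Free p S) {x : Signed Atom σ}
    (hx : p ∉ x.form.vars) : Free p (insert x S) := by
  rintro y (rfl | hy)
  · exact hx
  · exact h y hy

theorem Free.unbox {S : Set (Signed Atom σ)} (h : Free p S) (b : σ.Unary) :
    Free p (unbox b S) := by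
  rintro _ ⟨φ, rfl, hφ⟩
  simpa [vars_box] using h _ hφ

/-- The total size of a sequent. -/
def weight (S : Multiset (Signed Atom σ)) : ℕ := (S.map fun x => x.form.size).sum

@[simp] theorem weight_zero : weight (0 : Multiset (Signed Atom σ)) = 0 := rfl

@[simp] theorem weight_cons (x : Signed Atom σ) (S : Multiset (Signed Atom σ)) :
    weight (x ::ₘ S) = x.form.size + weight S := by
  simp [weight]

/-- The multiset version of `unbox`. -/
noncomputable def unboxMultiset (b : σ.Unary) (S : Multiset (Signed Atom σ)) :
    Multiset (Signed Atom σ) :=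
  S.filterMap (Sum.elim (fun φ => (Function.partialInv (box b) φ).map .inl) fun _ => none)

theorem unboxMultiset_cons_inr (b : σ.Unary) (φ : ClFormula Atom σ)
    (S : Multiset (Signed Atom σ)) : unboxMultiset b (.inr φ ::ₘ S) = unboxMultiset b S :=
  Multiset.filterMap_cons_none _ _ rfl

theorem setOf_mem_unboxMultiset (b : σ.Unary) (S : Multiset (Signed Atom σ)) :
    {x | x ∈ unboxMultiset b S} = unbox b {x | x ∈ S} := by
  ext x
  simp only [unboxMultiset, Multiset.mem_filterMap, Set.mem_ofPred_eq, unbox]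
  constructor
  · rintro ⟨ψ | ψ, hψ, h⟩
    · obtain ⟨φ, hφ, rfl⟩ := Option.map_eq_some_iff.1 h
      exact ⟨φ, rfl, by rwa [partialInv_box.1 hφ]⟩
    · simp at h
  · rintro ⟨φ, rfl, hφ⟩
    exact ⟨_, hφ, by simp [partialInv_box.2 rfl]⟩

/-- Each member of `S` costs at least one unit: it either loses its box or is discarded, and every
formula has positive size. -/
theorem weight_unboxMultiset (b : σ.Unary) (S : Multiset (Signed Atom σ)) :
    weight (unboxMultiset b S) + S.card ≤ weight S := by
  induction S using Multiset.induction_on with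
  | empty => simp [unboxMultiset]
  | cons x S ih =>
    have hx := size_pos x.form
    cases x with
    | inl ψ =>
      rcases h : Function.partialInv (box b) ψ with _ | φ
      · rw [unboxMultiset, Multiset.filterMap_cons_none _ _ (by simp [h])]
        simp only [weight_cons, Multiset.card_cons]
        unfold unboxMultiset at ih
        omega
      · rw [unboxMultiset, Multiset.filterMap_cons_some _ _ _ (b := .inl φ) (by simp [h])]
        obtain rfl := partialInv_box.1 h
        simp only [weight_cons, Multiset.card_cons, form_inl, size_box]
        unfold unboxMultiset at ih
        omega
    | inr ψ =>
      rw [unboxMultiset_cons_inr, weight_cons, Multiset.card_cons]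
      omega

/-- `A` is a uniform `p`-interpolant of the partial sequent `S`: it is `p`-free, it completes `S`
to a derivable sequent, and it follows from every `p`-free context that does so. -/
structure IsInterpolant (M : ModalVersion σ) (p : Atom) (S : Set (Signed Atom σ))
    (A : ClFormula Atom σ) : Prop where
  free : p ∉ A.vars
  left : Derivable M (insert (.inl A) S)
  right : ∀ T, Free p T → Derivable M (S ∪ T) → Derivable M (insert (.inr A) T)

theorem Derivable.negR {A : ClFormula Atom σ} {T : Set (Signed Atom σ)}
    (h : Derivable M (insert (.inl A) T)) : Derivable M (insert (.inr (imp A bot)) T) :=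
  .alpha (.impR _ _) (.inl rfl) (h.mono (by grind))

theorem Derivable.negL {A : ClFormula Atom σ} {T : Set (Signed Atom σ)}
    (h : Derivable M (insert (.inr A) T)) : Derivable M (insert (.inl (imp A bot)) T) :=
  .beta (.impL _ _) (.inl rfl) (h.mono (by grind)) (.closing .botL (.inl rfl))

/-- The disjuncts of the interpolant of a sequent `S` to which no propositional rule applies,
where `A` gives the interpolants of smaller sequents. -/
inductive Disjunct (M : ModalVersion σ) (p : Atom)
    (A : Multiset (Signed Atom σ) → ClFormula Atom σ) (S : Multiset (Signed Atom σ)) :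
    ClFormula Atom σ → Prop
  | idL {φ} (hp : p ∉ φ.vars) (hS : .inl φ ∈ S) : Disjunct M p A S (imp φ bot)
  | idR {φ} (hp : p ∉ φ.vars) (hS : .inr φ ∈ S) : Disjunct M p A S φ
  | box {b φ} (h : M.HasK b) (hS : .inr (box b φ) ∈ S) :
      Disjunct M p A S (ClFormula.box b (A (.inr φ ::ₘ unboxMultiset b S)))
  | diamond {b} (h : M.HasK b) :
      Disjunct M p A S (imp (ClFormula.box b (imp (A (unboxMultiset b S)) bot)) bot)

theorem Disjunct.finite (M : ModalVersion σ) (p : Atom)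
    (A : Multiset (Signed Atom σ) → ClFormula Atom σ) (S : Multiset (Signed Atom σ)) :
    {B | Disjunct M p A S B}.Finite := by
  have hmem : {x | x ∈ S}.Finite := by
    classical
    exact S.toFinset.finite_toSet.subset fun x hx => by simpa using hx
  have hφ (b : σ.Unary) : {φ | (.inr (ClFormula.box b φ) : Signed Atom σ) ∈ S}.Finite :=
    hmem.preimage (fun _ _ _ _ h => box_injective b (Sum.inr.inj h))
  have h₁ := hmem.image (Sum.elim (fun φ => imp φ bot) _root_.id)
  have h₂ := M.finite_hasK.biUnion fun b _ => (hφ b).image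
    (fun φ => ClFormula.box b (A (.inr φ ::ₘ unboxMultiset b S)))
  have h₃ := M.finite_hasK.image
    (fun b => imp (ClFormula.box b (imp (A (unboxMultiset b S)) bot)) bot)
  refine (h₁.union (h₂.union h₃)).subset ?_
  rintro B (h : Disjunct M p A S B)
  cases h with
  | idL hp hS => exact .inl ⟨_, hS, rfl⟩
  | idR hp hS => exact .inl ⟨_, hS, rfl⟩
  | box h hS => exact .inr (.inl (Set.mem_biUnion h ⟨_, hS, rfl⟩))
  | diamond h => exact .inr (.inr ⟨_, h, rfl⟩)

theorem weight_unboxMultiset_lt {S : Multiset (Signed Atom σ)} (hS₀ : S ≠ 0) (b : σ.Unary) :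
    weight (unboxMultiset b S) < weight S := by
  have := weight_unboxMultiset b S
  have := Multiset.card_pos.2 hS₀
  omega

theorem weight_cons_unboxMultiset_lt {S : Multiset (Signed Atom σ)} {b : σ.Unary}
    {φ : ClFormula Atom σ} (hS : .inr (box b φ) ∈ S) :
    weight (.inr φ ::ₘ unboxMultiset b S) < weight S := by
  obtain ⟨S', rfl⟩ := Multiset.exists_cons_of_mem hS
  have := weight_unboxMultiset b S'
  rw [unboxMultiset_cons_inr, weight_cons, weight_cons, form_inr, form_inr, size_box]
  omega

theorem setOf_mem_cons (x : Signed Atom σ) (S : Multiset (Signed Atom σ)) :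
    {y | y ∈ x ::ₘ S} = insert x {y | y ∈ S} := by
  ext y
  simp

theorem unbox_insert_inl_box (b : σ.Unary) (φ : ClFormula Atom σ) (S : Set (Signed Atom σ)) :
    insert (.inl φ) (unbox b S) ⊆ unbox b (insert (.inl (box b φ)) S) := by
  rintro x (rfl | ⟨ψ, rfl, hψ⟩)
  · exact ⟨φ, rfl, .inl rfl⟩
  · exact ⟨ψ, rfl, .inr hψ⟩

theorem unbox_union (b : σ.Unary) (S T : Set (Signed Atom σ)) :
    unbox b (S ∪ T) = unbox b S ∪ unbox b T := by
  ext x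
  simp only [unbox, Set.mem_ofPred_eq, Set.mem_union]
  grind

theorem Disjunct.sound {A : Multiset (Signed Atom σ) → ClFormula Atom σ}
    {S : Multiset (Signed Atom σ)} (hS₀ : S ≠ 0)
    (hA : ∀ S', weight S' < weight S → IsInterpolant M p {x | x ∈ S'} (A S'))
    {B : ClFormula Atom σ} (hB : Disjunct M p A S B) :
    p ∉ B.vars ∧ Derivable M (insert (.inl B) {x | x ∈ S}) := by
  cases hB with
  | @idL φ hp hS =>
    exact ⟨by simp [vars, hp], .negL (.id (.inr hS) (.inl rfl))⟩
  | idR hp hS => exact ⟨hp, .id (.inl rfl) (.inr hS)⟩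
  | @box b φ h hS =>
    have hI := hA _ (weight_cons_unboxMultiset_lt hS)
    refine ⟨by rw [vars_box]; exact hI.free, .ruleK b h (.inr hS) (hI.left.mono ?_)⟩
    rw [setOf_mem_cons, setOf_mem_unboxMultiset, Set.insert_comm]
    exact Set.insert_subset_insert (unbox_insert_inl_box _ _ _)
  | @diamond b h =>
    have hI := hA _ (weight_unboxMultiset_lt hS₀ b)
    refine ⟨by simp [vars, vars_box, hI.free], .negL (.ruleK b h (.inl rfl) (.negR ?_))⟩
    refine hI.left.mono (Set.insert_subset_insert ?_)
    rw [setOf_mem_unboxMultiset]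
    exact unbox_mono (Set.subset_insert _ _)

theorem exists_disjunction {s : Set (ClFormula Atom σ)} (hs : s.Finite) {S : Set (Signed Atom σ)}
    (h : ∀ B ∈ s, p ∉ B.vars ∧ Derivable M (insert (.inl B) S)) :
    ∃ A : ClFormula Atom σ, p ∉ A.vars ∧ Derivable M (insert (.inl A) S) ∧
      ∀ B ∈ s, ∀ T, Derivable M (insert (.inr B) T) → Derivable M (insert (.inr A) T) := by
  induction s, hs using Set.Finite.induction_on with
  | empty => exact ⟨bot, by simp [vars], .closing .botL (.inl rfl), by simp⟩
  | @insert B s _ _ ih =>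
    obtain ⟨A, hp, hl, hr⟩ := ih fun B hB => h B (.inr hB)
    obtain ⟨hp', hl'⟩ := h B (.inl rfl)
    refine ⟨or B A, by simp [vars, hp, hp'],
      .beta (.orL _ _) (.inl rfl) (hl'.mono (by grind)) (hl.mono (by grind)), ?_⟩
    rintro C (rfl | hC) T hT
    · exact .alpha (.orR _ _) (.inl rfl) (hT.mono (by grind))
    · exact .alpha (.orR _ _) (.inl rfl) ((hr C hC T hT).mono (by grind))

/-- Since `S` is irreducible, propositional inferences act in `T` only, where the induction
hypothesis applies to the enlarged `T`. Since `S` is not derivable, an axiom must use `T`. Contexts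
are shared, so no disjunct for splitting `S` is needed. -/
theorem Derivable.complete {A : Multiset (Signed Atom σ) → ClFormula Atom σ}
    {S : Multiset (Signed Atom σ)} (hS₀ : S ≠ 0) (hS : ¬ Derivable M {x | x ∈ S})
    (hα : ∀ x ∈ S, ∀ y z, ¬ Alpha x y z) (hβ : ∀ x ∈ S, ∀ y z, ¬ Beta x y z)
    (hA : ∀ S', weight S' < weight S → IsInterpolant M p {x | x ∈ S'} (A S'))
    {D : ClFormula Atom σ}
    (hD : ∀ B, Disjunct M p A S B → ∀ T, Derivable M (insert (.inr B) T) →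
      Derivable M (insert (.inr D) T))
    {U : Set (Signed Atom σ)} (hU : Derivable M U) :
    ∀ T, Free p T → U ⊆ {x | x ∈ S} ∪ T → Derivable M (insert (.inr D) T) := by
  induction hU with
  | @id U φ hl hr =>
    intro T hT hU
    rcases hU hl with hl | hl <;> rcases hU hr with hr | hr
    · exact absurd (.id hl hr) hS
    · exact hD _ (.idL (hT _ hr) hl) _ (.negR (.id (.inl rfl) (.inr hr)))
    · exact hD _ (.idR (hT _ hl) hr) _ (.id (.inr hl) (.inl rfl))
    · exact .id (.inr hl) (.inr hr)
  | closing h hx =>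
    intro T hT hU
    rcases hU hx with hx | hx
    · exact absurd (.closing h hx) hS
    · exact .closing h (.inr hx)
  | @alpha U x y z h hx _ ih =>
    intro T hT hU
    rcases hU hx with hx | hx
    · exact absurd h (hα _ hx _ _)
    · have hf := h.free (hT x hx)
      exact .alpha h (.inr hx) ((ih (insert y (insert z T)) ((hT.insert hf.2).insert hf.1)
        (by grind)).mono (by grind))
  | @beta U x y z h hx _ _ ih₁ ih₂ =>
    intro T hT hU
    rcases hU hx with hx | hx
    · exact absurd h (hβ _ hx _ _)
    · have hf := h.free (hT x hx)
      exact .beta h (.inr hx)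
        ((ih₁ (insert y T) (hT.insert hf.1) (by grind)).mono (by grind))
        ((ih₂ (insert z T) (hT.insert hf.2) (by grind)).mono (by grind))
  | @ruleK U φ b h hx h₁ _ =>
    intro T hT hU
    have hU' := unbox_mono (b := b) hU
    rw [unbox_union, ← setOf_mem_unboxMultiset] at hU'
    rcases hU hx with hx | hx
    · have hI := (hA _ (weight_cons_unboxMultiset_lt hx)).right (unbox b T) (hT.unbox b)
        (h₁.mono (by rw [setOf_mem_cons]; grind))
      exact hD _ (.box h hx) _ (.ruleK b h (.inl rfl)
        (hI.mono (Set.insert_subset_insert (unbox_mono (Set.subset_insert _ _)))))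
    · have hI := (hA _ (weight_unboxMultiset_lt hS₀ b)).right (insert (.inr φ) (unbox b T))
        ((hT.unbox b).insert (by simpa [vars_box] using hT _ hx)) (h₁.mono (by grind))
      -- The interpolant of the unboxed `S` crosses to the antecedent as a negation, is boxed
      -- together with `T` by `K`, and returns to the succedent as `¬□¬`.
      refine hD _ (.diamond h) _ (.negR (.ruleK b h (.inr hx) (hI.negL.mono ?_)))
      rw [Set.insert_comm]
      exact Set.insert_subset_insert (unbox_insert_inl_box _ _ _)
  | @ruleD U b h h₁ _ =>
    intro T hT hU
    have hU' := unbox_mono (b := b) hU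
    rw [unbox_union, ← setOf_mem_unboxMultiset] at hU'
    have hI := (hA _ (weight_unboxMultiset_lt hS₀ b)).right (unbox b T) (hT.unbox b)
      (h₁.mono hU')
    exact hD _ (.diamond (ModalVersion.hasK_of_hasD h)) _
      (.negR (.ruleD b h (hI.negL.mono (unbox_insert_inl_box _ _ _))))

/-- Invertibility makes the two sequents derivable in the same contexts, so one interpolant serves
both. -/
theorem IsInterpolant.alpha {x y z : Signed Atom σ} {S : Set (Signed Atom σ)}
    {A : ClFormula Atom σ} (h : Alpha x y z) (hA : IsInterpolant M p (insert y (insert z S)) A) :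
    IsInterpolant M p (insert x S) A where
  free := hA.free
  left := .alpha h (.inr (.inl rfl)) (hA.left.mono (by grind))
  right T hT hd := by
    refine hA.right T hT (hd.of_covers _ ?_)
    rintro w ((rfl | hw) | hw)
    · exact .alpha h (by simp) (by simp)
    · exact .mem (by simp [hw])
    · exact .mem (by simp [hw])

/-- By inversion, a context completes the conclusion exactly when it completes both premises, which
explains the conjunction. -/
theorem IsInterpolant.beta {x y z : Signed Atom σ} {S : Set (Signed Atom σ)}
    {A B : ClFormula Atom σ} (h : Beta x y z) (hA : IsInterpolant M p (insert y S) A)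
    (hB : IsInterpolant M p (insert z S) B) : IsInterpolant M p (insert x S) (and A B) where
  free := by simp [vars, hA.free, hB.free]
  left := .alpha (.andL _ _) (.inl rfl) (.beta h (by simp) (hA.left.mono (by grind))
    (hB.left.mono (by grind)))
  right T hT hd := by
    refine .beta (.andR _ _) (.inl rfl) ((hA.right T hT (hd.of_covers _ ?_)).mono (by grind))
      ((hB.right T hT (hd.of_covers _ ?_)).mono (by grind))
    · rintro w ((rfl | hw) | hw)
      · exact .beta₁ h (by simp)
      · exact .mem (by simp [hw])
      · exact .mem (by simp [hw])
    · rintro w ((rfl | hw) | hw)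
      · exact .beta₂ h (by simp)
      · exact .mem (by simp [hw])
      · exact .mem (by simp [hw])

/-- The recursion runs over multisets, on which total size is defined, although being an interpolant
depends only on the underlying set. Propositional rules are exhausted before any disjunction is
formed; a derivable irreducible sequent gets `⊤`. -/
theorem exists_isInterpolant (M : ModalVersion σ) (p : Atom) (n : ℕ) :
    ∀ S : Multiset (Signed Atom σ), weight S = n → ∃ A, IsInterpolant M p {x | x ∈ S} A := by
  induction n using Nat.strong_induction_on with
  | _ n ih =>
    rintro S rfl
    have ih' : ∀ S', weight S' < weight S → ∃ A, IsInterpolant M p {x | x ∈ S'} A :=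
      fun S' h => ih _ h S' rfl
    by_cases hS₀ : S = 0
    · subst hS₀
      exact ⟨bot, by simp [vars], .closing .botL (.inl rfl), fun T _ h => h.mono (by simp)⟩
    by_cases hα : ∃ x ∈ S, ∃ y z, Alpha x y z
    · obtain ⟨x, hx, y, z, h⟩ := hα
      obtain ⟨S', rfl⟩ := Multiset.exists_cons_of_mem hx
      obtain ⟨A, hA⟩ := ih' (y ::ₘ z ::ₘ S') (by have := h.size_lt; simp; omega)
      simp only [setOf_mem_cons] at hA ⊢
      exact ⟨A, hA.alpha h⟩
    by_cases hβ : ∃ x ∈ S, ∃ y z, Beta x y z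
    · obtain ⟨x, hx, y, z, h⟩ := hβ
      obtain ⟨S', rfl⟩ := Multiset.exists_cons_of_mem hx
      obtain ⟨A, hA⟩ := ih' (y ::ₘ S') (by have := h.size_lt; simp; omega)
      obtain ⟨B, hB⟩ := ih' (z ::ₘ S') (by have := h.size_lt; simp; omega)
      simp only [setOf_mem_cons] at hA hB ⊢
      exact ⟨and A B, hA.beta h hB⟩
    by_cases hS : Derivable M {x | x ∈ S}
    · exact ⟨top, by simp [vars], hS.mono (Set.subset_insert _ _),
        fun T _ _ => .closing .topR (.inl rfl)⟩
    push Not at hα hβ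
    have : Nonempty (ClFormula Atom σ) := ⟨top⟩
    choose! A hA using ih'
    obtain ⟨D, hp, hl, hr⟩ := exists_disjunction (Disjunct.finite M p A S)
      fun B hB => Disjunct.sound hS₀ hA hB
    exact ⟨D, hp, hl, fun T hT h => h.complete hS₀ hS hα hβ hA hr T hT subset_rfl⟩

theorem Derivable.imp_inv {φ ψ : ClFormula Atom σ} (h : Derivable M {.inr (imp φ ψ)}) :
    Derivable M {.inl φ, .inr ψ} := by
  refine h.of_covers _ ?_
  rintro x rfl
  exact .alpha (.impR φ ψ) (by simp) (by simp)

theorem Derivable.imp_intro {φ ψ : ClFormula Atom σ} (h : Derivable M {.inl φ, .inr ψ}) :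
    Derivable M {.inr (imp φ ψ)} :=
  .alpha (.impR φ ψ) rfl (h.mono (by grind))

end Signed

theorem uniformInterpolation (M : ModalVersion σ) :
    UniformInterpolation {φ : ClFormula Atom σ | Derives M 0 {φ}} := by
  intro φ p
  obtain ⟨A, hA⟩ := Signed.exists_isInterpolant M p _ {.inr φ} rfl
  obtain ⟨E, hE⟩ := Signed.exists_isInterpolant M p _ {.inl φ} rfl
  simp only [Multiset.mem_singleton, Set.ofPred_eq_eq_singleton] at hA hE
  simp only [Set.mem_ofPred_eq, derives_iff_derivable]
  refine ⟨A, imp E bot, hA.free, by simp [vars, hE.free], hA.left.imp_intro, ?_, ?_, ?_⟩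
  · intro ψ hψ h
    have := hA.right {.inl ψ} (by rintro x rfl; exact hψ) (h.imp_inv.mono (by grind))
    exact (this.mono (by grind)).imp_intro
  · exact (hE.left.negR.mono (by grind)).imp_intro
  · intro ψ hψ h
    have := hE.right {.inr ψ} (by rintro x rfl; exact hψ) (h.imp_inv.mono (by grind))
    exact this.negL.imp_intro

end ClFormula

theorem mainTheorem10 (Atom : Type u) (σ : Signature.{v}) :
    (SubFormula.UniformInterpolation (CFLe Atom (σ := σ) .none) ∧
      SubFormula.UniformInterpolation (CFLew Atom (σ := σ) .none) ∧
      ClFormula.UniformInterpolation (CPC Atom (σ := σ) .none)) ∧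
    (∀ b : σ.Unary,
      SubFormula.UniformInterpolation (CFLe Atom (.K b)) ∧
      SubFormula.UniformInterpolation (CFLew Atom (.K b)) ∧
      ClFormula.UniformInterpolation (CPC Atom (.K b))) ∧
    (∀ b : σ.Unary,
      SubFormula.UniformInterpolation (CFLe Atom (.KD b)) ∧
      SubFormula.UniformInterpolation (CFLew Atom (.KD b)) ∧
      ClFormula.UniformInterpolation (CPC Atom (.KD b))) :=
  have h (M : ModalVersion σ) : SubFormula.UniformInterpolation (CFLe Atom M) ∧
      SubFormula.UniformInterpolation (CFLew Atom M) ∧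
      ClFormula.UniformInterpolation (CPC Atom M) :=
    ⟨SubFormula.uniformInterpolation False M, SubFormula.uniformInterpolation True M,
      ClFormula.uniformInterpolation M⟩
  ⟨h _, fun _ => h _, fun _ => h _⟩
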